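/- All graphs are finite, simple and undirected. A graph property $\Pi$ is an isomorphism-closed class of graphs. It is *characterized by $c_\Pi\in\mathbb{N}$ adjacencies* if for every $G\in\Pi$ and every $v\in V(G)$ there is a set $D\subseteq V(G)\setminus\{v\}$ with $|D|\le c_\Pi$ such that every graph obtained from $G$ by adding or removing edges between $v$ and vertices of $V(G)\setminus D$ is again in $\Pi$. Let $\mathrm{vc}(G)$ denote the minimum size of a vertex cover of $G$. *Largest Induced $\Pi$-Subgraph parameterized by vertex cover* is the following parameterized problem: an instance consists of a graph $G$, a vertex cover $X$ of $G$ and an integer $k\ge 1$; the parameter is $|X|$; the question is whether there is a set $P\subseteq V(G)$ with $|P|\ge k$ and $G[P]\in\Pi$. A *kernelization* is a polynomial-time algorithm that maps every instance to an equivalent instance (of the same problem) whose encoding length and parameter are bounded by a function of the parameter of the input. **Theorem.** Let $\Pi$ be a graph property such that 1. $\Pi$ is characterized by $c_\Pi$ adjacencies, and 2. there is a non-decreasing polynomial $p\colon\mathbb{N}\to\mathbb{N}$ such that $|V(G)|\le p(\mathrm{vc}(G))$ for all $G\in\Pi$. Then Largest Induced $\Pi$-Subgraph parameterized by vertex cover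 has a kernelization, with encoding length and parameter of the output bounded by a polynomial in $x:=|X|$, in which the graph of the output instance has $O(p(x)\cdot x^{c_\Pi})$ vertices, that is, at most $f(x)$ vertices for a function $f\colon\mathbb{N}\to\mathbb{N}$ with $f(x)=O(p(x)\cdot x^{c_\Pi})$ as $x\to\infty$. -/

import Mathlib

open Filter Asymptotics

/-- A graph property: a class of finite simple graphs, closed under isomorphism. -/
structure GraphProperty where
  /-- membership of a finite graph in the class -/
  Holds : ∀ {V : Type} [Finite V], SimpleGraph V → Prop
  /-- isomorphic graphs are not distinguished -/
  iso_closed : ∀ {V W : Type} [Finite V] [Finite W] (G : SimpleGraph V) (H : SimpleGraph W),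
    Nonempty (G ≃g H) → Holds G → Holds H

/-- `Φ` is characterized by `c` adjacencies: for every `G ∈ Φ` and every vertex `v` there is a set
`D` of at most `c` vertices other than `v`, such that every graph `G'` on the same vertex set which
differs from `G` only in pairs `{v, u}` with `u ∉ D` is again in `Φ`. -/
def GraphProperty.CharacterizedByAdjacencies (Φ : GraphProperty) (c : ℕ) : Prop :=
  ∀ {V : Type} [Finite V] (G : SimpleGraph V), Φ.Holds G → ∀ v : V,
    ∃ D : Finset V, v ∉ D ∧ D.card ≤ c ∧
      ∀ G' : SimpleGraph V,
        (∀ a b : V, a ≠ v → b ≠ v → (G'.Adj a b ↔ G.Adj a b)) →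
        (∀ u ∈ D, (G'.Adj v u ↔ G.Adj v u)) →
        Φ.Holds G'

/-- A parameterized problem over a finite alphabet: the instances, their encoding as strings,
the parameter of an instance, and the set of yes-instances. -/
structure ParameterizedProblem where
  /-- the (well-formed) instances -/
  Inst : Type
  /-- the alphabet of the encoding -/
  Alphabet : Type
  /-- the alphabet is finite -/
  finite_alphabet : Finite Alphabet
  /-- the encoding of instances as strings -/
  encode : Inst → List Alphabet
  /-- distinct instances have distinct encodings -/
  encode_injective : Function.Injective encode
  /-- the parameter of an instance -/
  param : Inst → ℕ
  /-- the yes-instances -/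
  Yes : Inst → Prop

/-- `K` is a kernelization for `Q` of size at most `size`: it is computed by a (multi-stack) Turing
machine in time polynomial in the length of the encoded instance, it maps each instance to an
equivalent one, and the length of the encoding of the output and the parameter of the output are
at most `size` of the parameter of the input. -/
structure IsKernelization (Q : ParameterizedProblem) (K : Q.Inst → Q.Inst) (size : ℕ → ℕ) :
    Prop where
  polyTime : Nonempty (Turing.TM2ComputableInPolyTime Q.encode Q.encode K)
  equivalent : ∀ I : Q.Inst, Q.Yes (K I) ↔ Q.Yes I
  length_le : ∀ I : Q.Inst, (Q.encode (K I)).length ≤ size (Q.param I)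
  param_le : ∀ I : Q.Inst, Q.param (K I) ≤ size (Q.param I)

/-- A graph `G` (on the vertices `0, …, n - 1`) with a vertex cover `X` and an integer `k ≥ 1`. -/
structure VCInstance where
  /-- the number of vertices -/
  n : ℕ
  /-- the graph -/
  G : SimpleGraph (Fin n)
  /-- the given vertex cover -/
  X : Finset (Fin n)
  /-- `X` is a vertex cover of `G` -/
  cover : G.IsVertexCover (X : Set (Fin n))
  /-- the target value -/
  k : ℕ
  /-- the target value is positive -/
  one_le_k : 1 ≤ k

open Classical in
/-- The row of vertex `i`: one bit telling whether `i ∈ X`, followed by the `i`-th row of the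
adjacency matrix of `G`. -/
noncomputable def VCInstance.row (I : VCInstance) (i : Fin I.n) : List Bool :=
  decide (i ∈ I.X) :: (List.finRange I.n).map fun j => decide (I.G.Adj i j)

/-- The encoding of `(G, X, k)` over the alphabet `{0, 1, #}` (where `none` is the separator `#`):
the number `k` in binary, followed by the rows of all vertices, each of these blocks being
terminated by `#`. -/
noncomputable def VCInstance.encode (I : VCInstance) : List (Option Bool) :=
  ((Computability.encodeNat I.k).map some ++ [none]) ++
    (List.finRange I.n).flatMap fun i => (I.row i).map some ++ [none]

theorem VCInstance.block_inj {l l' : List Bool} {r r' : List (Option Bool)}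
    (h : (l.map some ++ [none]) ++ r = (l'.map some ++ [none]) ++ r') : l = l' ∧ r = r' := by
  induction l generalizing l' with
  | nil => cases l' <;> simp_all
  | cons a l ih =>
    cases l' with
    | nil => simp at h
    | cons b l' =>
      simp only [List.map_cons, List.cons_append, List.cons.injEq, Option.some.injEq] at h
      obtain ⟨h1, h2⟩ := ih h.2
      exact ⟨by rw [h.1, h1], h2⟩

theorem VCInstance.blocks_inj {L L' : List (List Bool)}
    (h : L.flatMap (fun l => l.map some ++ [none]) = L'.flatMap (fun l => l.map some ++ [none])) :
    L = L' := by
  induction L generalizing L' with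
  | nil => cases L' <;> simp_all
  | cons a L ih =>
    cases L' with
    | nil => simp at h
    | cons b L' =>
      rw [List.flatMap_cons, List.flatMap_cons] at h
      obtain ⟨h1, h2⟩ := VCInstance.block_inj h
      rw [h1, ih h2]

theorem VCInstance.encode_injective : Function.Injective VCInstance.encode := by
  intro I J h
  obtain ⟨hk, hr⟩ := VCInstance.block_inj h
  have hk' : I.k = J.k := by
    rw [← Computability.decode_encodeNat I.k, hk, Computability.decode_encodeNat]
  have hrows : (List.finRange I.n).map I.row = (List.finRange J.n).map J.row := by
    apply VCInstance.blocks_inj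
    simpa [List.flatMap_map] using hr
  obtain ⟨n, G, X, cover, k, hk1⟩ := I
  obtain ⟨n', G', X', cover', k', hk1'⟩ := J
  have hn : n = n' := by simpa using congrArg List.length hrows
  subst hn
  dsimp only at hk'
  subst hk'
  have hrow : ∀ i, VCInstance.row ⟨n, G, X, cover, k, hk1⟩ i =
      VCInstance.row ⟨n, G', X', cover', k, hk1'⟩ i := by
    intro i
    exact List.map_inj_left.mp hrows i (List.mem_finRange i)
  simp only [VCInstance.row, List.cons.injEq, decide_eq_decide, List.map_inj_left,
    List.mem_finRange, true_implies] at hrow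
  have hX : X = X' := Finset.ext fun i => (hrow i).1
  have hG : G = G' := by
    ext i j
    exact (hrow i).2 j
  subst hX hG
  rfl

/-- The problem Largest Induced `Φ`-Subgraph parameterized by a given vertex cover:
given a graph `G` with a vertex cover `X` and an integer `k ≥ 1`, with parameter `|X|`, is there a
set `P` of at least `k` vertices such that the induced subgraph `G[P]` is in `Φ`? -/
noncomputable def largestInducedVC (Φ : GraphProperty) : ParameterizedProblem where
  Inst := VCInstance
  Alphabet := Option Bool
  finite_alphabet := inferInstance
  encode := VCInstance.encode
  encode_injective := VCInstance.encode_injective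
  param I := I.X.card
  Yes I := ∃ P : Finset (Fin I.n), I.k ≤ P.card ∧ Φ.Holds (I.G.induce (P : Set (Fin I.n)))

/-!
The reduction keeps the given vertex cover `X` and, for every choice of at most `c` vertices of `X`
together with a prescribed adjacency to each of them, the first `ℓ` vertices outside `X` with these
adjacencies, where `ℓ = C * (|X| + 1) ^ d` is at least `p |X|`. These are at most
`|X| + (2 * |X| + 1) ^ c * ℓ` vertices.

*Correctness.* A solution `P` has at most `p |X| ≤ ℓ` vertices, because a vertex cover of `G`
restricts to one of `G[P]`. Let `v ∈ P` be a vertex which is not kept, and let `D ⊆ P` be the set of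
at most `c` vertices which characterizes the adjacencies of `v` in `G[P]`. As `v` was not kept, there
are `ℓ` kept vertices outside `X` with the adjacencies of `v` to `D ∩ X`; one of them, `u`, is not
in `P`, as `P` has at most `ℓ` elements including `v`. Vertices outside `X` are pairwise
non-adjacent, so `u` and `v` have the same neighbours in `D`, and `v` can be exchanged for `u`
(`GraphProperty.CharacterizedByAdjacencies.exists_exchange`). Repeating this, all of `P` moves into
the kept vertices (`exists_subset_of_exchange`, `VCInstance.yes_restrict_keptMask_iff`). The target
`k` is replaced by something longer than the number of kept vertices if it is too long, which bounds
the encoding length.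

*The degenerate case.* If `c = 0`, then `X` itself would exceed the bound `O(p x)` for bounded `p`.
But then all adjacencies are irrelevant to the property, so that solutions have at most `p 0`
vertices, and any `p 0` vertices are enough. If `p` vanishes identically, there are no nonempty
solutions, and the empty graph is kept.

*Running time.* A kernelization is a function computed by a polynomial time Turing machine
(`Turing.FinTM2`). Programs of a small structured language over finitely many stacks
(`StackProg`), with exact step counts, are compiled to such machines
(`StackProg.tm2ComputableInPolyTime`). The reduction is written in this language, for a fixed number
of stacks (`Reg`), as a function on the bit table of the instance: `RegProg.runs_kernelize` gives its
result and running time. The vertices to be kept are found by a recursion of depth `c` over the rows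
of `X` (`RegProg.mark`), where each step splits the set of candidates into neighbours and
non-neighbours.
-/

/-! ### Structured programs over finitely many stacks -/

/-- Structured programs which act on stacks indexed by `K`, with entries in `A`. -/
inductive StackProg (K A : Type) : Type
  /-- do nothing -/
  | skip : StackProg K A
  /-- push the symbol `a` onto the stack `k` -/
  | push (k : K) (a : A) : StackProg K A
  /-- run the first program, then the second one -/
  | seq (P Q : StackProg K A) : StackProg K A
  /-- pop a symbol from the stack `k` (`none` if it is empty) and branch on it -/
  | case (k : K) (f : Option A → StackProg K A) : StackProg K A
  /-- pop a symbol from the stack `k`; if it satisfies `c`, run the program that `f` assigns to it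
  and repeat; otherwise leave the loop (the popped symbol is lost) -/
  | loop (k : K) (c : Option A → Bool) (f : Option A → StackProg K A) : StackProg K A

namespace StackProg

variable {K A : Type}

/-- Control points of a program. -/
def Label : StackProg K A → Type
  | skip => Unit
  | push _ _ => Unit
  | seq P Q => P.Label ⊕ Q.Label
  | case _ f => Option (Σ o, (f o).Label)
  | loop _ _ f => Option (Σ o, (f o).Label)

noncomputable instance fintypeLabel [Fintype A] : (P : StackProg K A) → Fintype P.Label
  | skip => inferInstanceAs (Fintype Unit)
  | push _ _ => inferInstanceAs (Fintype Unit)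
  | seq P Q =>
    letI := fintypeLabel P
    letI := fintypeLabel Q
    inferInstanceAs (Fintype (P.Label ⊕ Q.Label))
  | case _ f =>
    letI := fun o => fintypeLabel (f o)
    inferInstanceAs (Fintype (Option (Σ o, (f o).Label)))
  | loop _ _ f =>
    letI := fun o => fintypeLabel (f o)
    inferInstanceAs (Fintype (Option (Σ o, (f o).Label)))

/-- The control point at which a program starts. -/
def entry : (P : StackProg K A) → P.Label
  | skip => ()
  | push _ _ => ()
  | seq P _ => Sum.inl P.entry
  | case _ _ => none
  | loop _ _ _ => none

/-- The `TM2` statement at a control point of a program, when `e` embeds the control points into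
the labels of a machine and `x` is the label to continue with after the program. The internal state
of the machine is the symbol popped last. -/
def stmt {Λ : Type} : (P : StackProg K A) → (P.Label → Λ) → Λ → P.Label →
    Turing.TM2.Stmt (fun _ : K => A) Λ (Option A)
  | skip, _, x, _ => .goto fun _ => x
  | push k a, _, x, _ => .push k (fun _ => a) (.goto fun _ => x)
  | seq P Q, e, _, Sum.inl l => P.stmt (fun l => e (Sum.inl l)) (e (Sum.inr Q.entry)) l
  | seq _ Q, e, x, Sum.inr l => Q.stmt (fun l => e (Sum.inr l)) x l
  | case k f, e, _, none =>
    .pop k (fun _ o => o) (.goto fun o => e (some ⟨o, (f o).entry⟩))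
  | case _ f, e, x, some ⟨o, l⟩ => (f o).stmt (fun l => e (some ⟨o, l⟩)) x l
  | loop k c f, e, x, none =>
    .pop k (fun _ o => o) (.goto fun o => if c o then e (some ⟨o, (f o).entry⟩) else x)
  | loop _ _ f, e, _, some ⟨o, l⟩ => (f o).stmt (fun l => e (some ⟨o, l⟩)) (e none) l

variable [DecidableEq K]

/-- `P.Exec S S' t`: started with the stacks `S`, the program `P` ends with the stacks `S'` after
`t` steps. -/
inductive Exec : StackProg K A → (K → List A) → (K → List A) → ℕ → Prop
  | skip (S) : Exec skip S S 1
  | push (k a S) : Exec (push k a) S (Function.update S k (a :: S k)) 1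
  | seq {P Q S S₁ S₂ t₁ t₂} : Exec P S S₁ t₁ → Exec Q S₁ S₂ t₂ → Exec (seq P Q) S S₂ (t₁ + t₂)
  | case {k f S S' t} : Exec (f (S k).head?) (Function.update S k (S k).tail) S' t →
      Exec (case k f) S S' (1 + t)
  | loop_exit {k c f S} : c (S k).head? = false →
      Exec (loop k c f) S (Function.update S k (S k).tail) 1
  | loop_step {k c f S S₁ S₂ t₁ t₂} : c (S k).head? = true →
      Exec (f (S k).head?) (Function.update S k (S k).tail) S₁ t₁ →
      Exec (loop k c f) S₁ S₂ t₂ → Exec (loop k c f) S S₂ (1 + t₁ + t₂)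

open Turing in
/-- A machine that contains the statements of `P` simulates the runs of `P` step by step. -/
theorem Exec.simulate {Λ : Type} (M : Λ → TM2.Stmt (fun _ : K => A) Λ (Option A))
    {P : StackProg K A} {S S' : K → List A} {t : ℕ} (h : P.Exec S S' t) :
    ∀ (e : P.Label → Λ) (x : Λ), (∀ l, M (e l) = P.stmt e x l) → ∀ v, ∃ v',
      (flip Bind.bind (TM2.step M))^[t] (some ⟨some (e P.entry), v, S⟩) = some ⟨some x, v', S'⟩ := by
  induction h with
  | skip S =>
    intro e x hM v
    exact ⟨v, by simp [flip, hM, stmt]⟩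
  | push k a S =>
    intro e x hM v
    exact ⟨v, by simp [flip, hM, stmt]⟩
  | @seq P Q S S₁ S₂ t₁ t₂ _ _ ih₁ ih₂ =>
    intro e x hM v
    obtain ⟨v₁, h₁⟩ := ih₁ (fun l => e (Sum.inl l)) (e (Sum.inr Q.entry))
      (fun l => hM (Sum.inl l)) v
    obtain ⟨v₂, h₂⟩ := ih₂ (fun l => e (Sum.inr l)) x (fun l => hM (Sum.inr l)) v₁
    exact ⟨v₂, by rw [add_comm, Function.iterate_add_apply]; exact (congrArg _ h₁).trans h₂⟩
  | @case k f S S' t _ ih =>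
    intro e x hM v
    have hp : M (e none) =
        .pop k (fun _ o => o) (.goto fun o => e (some ⟨o, (f o).entry⟩)) := hM none
    obtain ⟨v₁, h₁⟩ := ih (fun l => e (some ⟨_, l⟩)) x (fun l => hM (some ⟨_, l⟩)) (S k).head?
    refine ⟨v₁, ?_⟩
    rw [add_comm, Function.iterate_add_apply, ← h₁]
    simp [flip, entry, hp]
  | @loop_exit k c f S hc =>
    intro e x hM v
    have hp : M (e none) = .pop k (fun _ o => o)
        (.goto fun o => if c o then e (some ⟨o, (f o).entry⟩) else x) := hM none
    exact ⟨(S k).head?, by simp [flip, entry, hp, hc]⟩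
  | @loop_step k c f S S₁ S₂ t₁ t₂ hc _ _ ih₁ ih₂ =>
    intro e x hM v
    have hp : M (e none) = .pop k (fun _ o => o)
        (.goto fun o => if c o then e (some ⟨o, (f o).entry⟩) else x) := hM none
    obtain ⟨v₁, h₁⟩ := ih₁ (fun l => e (some ⟨_, l⟩)) (e none) (fun l => hM (some ⟨_, l⟩))
      (S k).head?
    obtain ⟨v₂, h₂⟩ := ih₂ e x hM v₁
    refine ⟨v₂, ?_⟩
    rw [← h₂, add_comm, Function.iterate_add_apply, add_comm 1, Function.iterate_add_apply]
    congr 1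
    refine Eq.trans ?_ h₁
    congr 1
    simp [flip, entry, hp, hc]

variable [Fintype K] [Fintype A]

/-- The machine that runs `P`, resets its internal state and halts. -/
noncomputable def machine (P : StackProg K A) (k₀ k₁ : K) : Turing.FinTM2 where
  K := K
  k₀ := k₀
  k₁ := k₁
  Γ _ := A
  Λ := Option P.Label
  main := some P.entry
  σ := Option A
  initialState := none
  Γk₀Fin := inferInstanceAs (Fintype A)
  m
    | none => .load (fun _ => none) .halt
    | some l => P.stmt some none l

theorem initList_machine (P : StackProg K A) (k₀ k₁ : K) (l : List A) :
    Turing.initList (P.machine k₀ k₁) l =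
      ⟨some (some P.entry), none, Function.update (fun _ => []) k₀ l⟩ := by
  refine congrArg (Turing.TM2.Cfg.mk (some (some P.entry)) none) (funext fun k => ?_)
  by_cases hk : k = k₀
  · rw [hk]
    exact (dif_pos rfl).trans (Function.update_self (β := fun _ => List A) k₀ l _).symm
  · exact (dif_neg hk).trans (Function.update_of_ne (β := fun _ => List A) hk l (fun _ => [])).symm

theorem haltList_machine (P : StackProg K A) (k₀ k₁ : K) (l : List A) :
    Turing.haltList (P.machine k₀ k₁) l = ⟨none, none, Function.update (fun _ => []) k₁ l⟩ := by
  refine congrArg (Turing.TM2.Cfg.mk none none) (funext fun k => ?_)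
  by_cases hk : k = k₁
  · rw [hk]
    exact (dif_pos rfl).trans (Function.update_self (β := fun _ => List A) k₁ l _).symm
  · exact (dif_neg hk).trans (Function.update_of_ne (β := fun _ => List A) hk l (fun _ => [])).symm

/-- If `P` turns the encoding of each `a` on the otherwise empty stacks into the encoding of `f a`
on the otherwise empty stacks in polynomial time, then `f` is computable in polynomial time. -/
theorem tm2ComputableInPolyTime {α β : Type} {ea : α → List A} {eb : β → List A} {f : α → β}
    (P : StackProg K A) (k₀ k₁ : K) (q : Polynomial ℕ)
    (h : ∀ a, ∃ t ≤ q.eval (ea a).length,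
      P.Exec (Function.update (fun _ => []) k₀ (ea a))
        (Function.update (fun _ => []) k₁ (eb (f a))) t) :
    Nonempty (Turing.TM2ComputableInPolyTime ea eb f) := by
  refine ⟨{
    tm := P.machine k₀ k₁
    inputAlphabet := Equiv.refl A
    outputAlphabet := Equiv.refl A
    time := q + 1
    outputsFun := fun a => ?_ }⟩
  have hin := initList_machine P k₀ k₁ (ea a)
  have hout := haltList_machine P k₀ k₁ (eb (f a))
  rw [← List.map_id (ea a)] at hin
  rw [← List.map_id (eb (f a))] at hout
  have key : ∃ t ≤ q.eval (ea a).length, (flip Bind.bind (P.machine k₀ k₁).step)^[t + 1]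
      (some (Turing.initList (P.machine k₀ k₁) (List.map (Equiv.refl A).invFun (ea a)))) =
      some (Turing.haltList (P.machine k₀ k₁) (List.map (Equiv.refl A).invFun (eb (f a)))) := by
    obtain ⟨t, ht, he⟩ := h a
    obtain ⟨v, hv⟩ := he.simulate (P.machine k₀ k₁).m some none (fun l => rfl) none
    refine ⟨t, ht, ?_⟩
    rw [add_comm, Function.iterate_add_apply]
    refine (congrArg _ (congrArg _ (congrArg some hin))).trans
      (Eq.trans ?_ (congrArg some hout).symm)
    rw [List.map_id, List.map_id]
    exact (congrArg _ hv).trans rfl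
  refine ⟨⟨key.choose + 1, key.choose_spec.2⟩, ?_⟩
  simpa using key.choose_spec.1

end StackProg

/-! ### Running programs on named stacks -/

/-- Names of the stacks of the kernelization program. -/
inductive Reg
  | inp | kb | mask | lim | cnt | rows | frames | iter | t1 | t2 | t3 | out
  deriving DecidableEq

instance : Fintype Reg where
  elems := {.inp, .kb, .mask, .lim, .cnt, .rows, .frames, .iter, .t1, .t2, .t3, .out}
  complete k := by cases k <;> decide

/-- The contents of all stacks; the first symbol of a list is the top of its stack. -/
structure Stacks where
  /-- the input, later the encoded rows of the graph, and finally the output -/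
  inp : List (Option Bool)
  /-- the binary digits of the target value -/
  kb : List (Option Bool)
  /-- one bit per vertex: is it kept? -/
  mask : List (Option Bool)
  /-- in unary, how many vertices are kept for each candidate set -/
  lim : List (Option Bool)
  /-- a unary counter -/
  cnt : List (Option Bool)
  /-- the encoded rows of the vertices of the given vertex cover -/
  rows : List (Option Bool)
  /-- characteristic vectors of candidate sets, each terminated by a separator -/
  frames : List (Option Bool)
  /-- lists of rows that remain to be processed by the enclosing loops, each terminated by an
  additional separator -/
  iter : List (Option Bool)
  /-- scratch -/
  t1 : List (Option Bool)
  /-- scratch -/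
  t2 : List (Option Bool)
  /-- scratch -/
  t3 : List (Option Bool)
  /-- the output, in reverse order -/
  out : List (Option Bool)

namespace Stacks

/-- The content of a stack. -/
def get (s : Stacks) : Reg → List (Option Bool)
  | .inp => s.inp
  | .kb => s.kb
  | .mask => s.mask
  | .lim => s.lim
  | .cnt => s.cnt
  | .rows => s.rows
  | .frames => s.frames
  | .iter => s.iter
  | .t1 => s.t1
  | .t2 => s.t2
  | .t3 => s.t3
  | .out => s.out

/-- Replace the content of a stack. -/
def set (s : Stacks) (k : Reg) (l : List (Option Bool)) : Stacks :=
  match k with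
  | .inp => { s with inp := l }
  | .kb => { s with kb := l }
  | .mask => { s with mask := l }
  | .lim => { s with lim := l }
  | .cnt => { s with cnt := l }
  | .rows => { s with rows := l }
  | .frames => { s with frames := l }
  | .iter => { s with iter := l }
  | .t1 => { s with t1 := l }
  | .t2 => { s with t2 := l }
  | .t3 => { s with t3 := l }
  | .out => { s with out := l }

@[simp]
theorem get_set_self (s : Stacks) (k : Reg) (l : List (Option Bool)) : (s.set k l).get k = l := by
  cases k <;> rfl

theorem get_set_of_ne {k k' : Reg} (h : k' ≠ k) (s : Stacks) (l : List (Option Bool)) :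
    (s.set k l).get k' = s.get k' := by
  cases k <;> cases k' <;> first | rfl | exact absurd rfl h

@[simp]
theorem set_get (s : Stacks) (k : Reg) : s.set k (s.get k) = s := by
  cases k <;> rfl

@[simp]
theorem set_set_self (s : Stacks) (k : Reg) (l l' : List (Option Bool)) :
    (s.set k l).set k l' = s.set k l' := by
  cases k <;> rfl

theorem set_comm {k k' : Reg} (h : k ≠ k') (s : Stacks) (l l' : List (Option Bool)) :
    (s.set k l).set k' l' = (s.set k' l').set k l := by
  cases k <;> cases k' <;> first | rfl | exact absurd rfl h

theorem update_get (s : Stacks) (k : Reg) (l : List (Option Bool)) :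
    Function.update s.get k l = (s.set k l).get := by
  funext k'
  by_cases h : k' = k
  · subst h
    simp
  · rw [Function.update_of_ne h, get_set_of_ne h]

/-- All stacks are empty. -/
def empty : Stacks := ⟨[], [], [], [], [], [], [], [], [], [], [], []⟩

theorem get_empty : empty.get = fun _ => [] := by
  funext k
  cases k <;> rfl

end Stacks

/-- Programs over the named stacks and the alphabet `{0, 1, #}`. -/
abbrev RegProg := StackProg Reg (Option Bool)

namespace RegProg

open StackProg

/-- `Runs P s s' t`: started with the stacks `s`, the program `P` ends with the stacks `s'` after at
most `t` steps. -/
def Runs (P : RegProg) (s s' : Stacks) (t : ℕ) : Prop :=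
  ∃ t' ≤ t, P.Exec s.get s'.get t'

theorem Runs.to {P : RegProg} {s s₁ s₂ : Stacks} {t t' : ℕ} (h : Runs P s s₁ t) (hs : s₁ = s₂)
    (ht : t ≤ t') : Runs P s s₂ t' := by
  obtain ⟨u, hu, he⟩ := h
  exact ⟨u, hu.trans ht, hs ▸ he⟩

theorem Runs.of_eq {P : RegProg} {s₁ s s' : Stacks} {t : ℕ} (hs : s₁ = s) (h : Runs P s s' t) :
    Runs P s₁ s' t :=
  hs ▸ h

theorem Runs.skip (s : Stacks) : Runs skip s s 1 :=
  ⟨1, le_rfl, .skip _⟩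

theorem Runs.push (k : Reg) (a : Option Bool) (s : Stacks) :
    Runs (push k a) s (s.set k (a :: s.get k)) 1 := by
  refine ⟨1, le_rfl, ?_⟩
  rw [← Stacks.update_get]
  exact .push ..

theorem Runs.seq {P Q : RegProg} {s s₁ s₂ : Stacks} {t₁ t₂ : ℕ} (h₁ : Runs P s s₁ t₁)
    (h₂ : Runs Q s₁ s₂ t₂) : Runs (seq P Q) s s₂ (t₁ + t₂) := by
  obtain ⟨u₁, hu₁, he₁⟩ := h₁
  obtain ⟨u₂, hu₂, he₂⟩ := h₂
  exact ⟨u₁ + u₂, by omega, .seq he₁ he₂⟩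

theorem Runs.case {k : Reg} {f : Option (Option Bool) → RegProg} {s s' : Stacks} {t : ℕ}
    (h : Runs (f (s.get k).head?) (s.set k (s.get k).tail) s' t) :
    Runs (case k f) s s' (t + 1) := by
  obtain ⟨u, hu, he⟩ := h
  rw [← Stacks.update_get] at he
  exact ⟨1 + u, by omega, .case he⟩

theorem Runs.loop_exit {k : Reg} {c : Option (Option Bool) → Bool}
    {f : Option (Option Bool) → RegProg} {s : Stacks} (h : c (s.get k).head? = false) :
    Runs (loop k c f) s (s.set k (s.get k).tail) 1 := by
  refine ⟨1, le_rfl, ?_⟩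
  rw [← Stacks.update_get]
  exact .loop_exit h

theorem Runs.loop_step {k : Reg} {c : Option (Option Bool) → Bool}
    {f : Option (Option Bool) → RegProg} {s s₁ s₂ : Stacks} {t₁ t₂ : ℕ}
    (h : c (s.get k).head? = true)
    (h₁ : Runs (f (s.get k).head?) (s.set k (s.get k).tail) s₁ t₁)
    (h₂ : Runs (loop k c f) s₁ s₂ t₂) : Runs (loop k c f) s s₂ (1 + t₁ + t₂) := by
  obtain ⟨u₁, hu₁, he₁⟩ := h₁
  obtain ⟨u₂, hu₂, he₂⟩ := h₂
  rw [← Stacks.update_get] at he₁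
  exact ⟨1 + u₁ + u₂, by omega, .loop_step h he₁ he₂⟩

/-- A loop that processes the items of a list `L` one by one: `S d r` are the stacks when the items
`d` are done and the items `r` remain. -/
theorem Runs.loop_items {X : Type} {k : Reg} {c : Option (Option Bool) → Bool}
    {f : Option (Option Bool) → RegProg} (S : List X → List X → Stacks) (L : List X) (t : ℕ)
    (hstep : ∀ d x r, L = d ++ x :: r → c ((S d (x :: r)).get k).head? = true ∧
      Runs (f ((S d (x :: r)).get k).head?)
        ((S d (x :: r)).set k ((S d (x :: r)).get k).tail) (S (d ++ [x]) r) t)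
    (hexit : c ((S L []).get k).head? = false) :
    Runs (loop k c f) (S [] L) ((S L []).set k ((S L []).get k).tail)
      (L.length * (t + 1) + 1) := by
  suffices H : ∀ r d, L = d ++ r → Runs (loop k c f) (S d r)
      ((S L []).set k ((S L []).get k).tail) (r.length * (t + 1) + 1) from H L [] rfl
  intro r
  induction r with
  | nil =>
    intro d hd
    rw [List.append_nil] at hd
    subst hd
    exact (Runs.loop_exit hexit).to rfl (by simp)
  | cons x r ih =>
    intro d hd
    obtain ⟨h₁, h₂⟩ := hstep d x r hd
    exact (Runs.loop_step h₁ h₂ (ih (d ++ [x]) (by simp [hd]))).to rfl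
      (by simp only [List.length_cons]; ring_nf; omega)

/-- Sequential composition of programs. -/
scoped infixr:65 " ;; " => StackProg.seq

/-- Pop the symbols of the stack `k` until it is empty and run `f` on each. -/
def drain (k : Reg) (f : Option Bool → RegProg) : RegProg :=
  loop k Option.isSome fun o => o.elim skip f

/-- Is the popped symbol a bit (and not a separator)? -/
def isBit : Option (Option Bool) → Bool
  | some (some _) => true
  | _ => false

/-- Pop the bits of the stack `k` up to and including the next separator and run `f` on each
bit. -/
def bits (k : Reg) (f : Bool → RegProg) : RegProg :=
  loop k isBit fun o => o.elim skip fun a => a.elim skip f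

theorem Runs.drain {k : Reg} {f : Option Bool → RegProg}
    (S : List (Option Bool) → List (Option Bool) → Stacks) (L : List (Option Bool)) (t : ℕ)
    (hk : ∀ d r, (S d r).get k = r)
    (hstep : ∀ d x r, Runs (f x) ((S d (x :: r)).set k r) (S (d ++ [x]) r) t) :
    Runs (drain k f) (S [] L) (S L []) (L.length * (t + 1) + 1) := by
  refine (Runs.loop_items S L t (fun d x r _ => ?_) (by rw [hk]; rfl)).to ?_ le_rfl
  · rw [hk]
    exact ⟨rfl, hstep d x r⟩
  · conv_rhs => rw [← (S L []).set_get k]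
    rw [hk]
    rfl

theorem Runs.bits {k : Reg} {f : Bool → RegProg} (S : List Bool → List Bool → Stacks)
    (L : List Bool) (rest : List (Option Bool)) (t : ℕ)
    (hk : ∀ d r, (S d r).get k = r.map some ++ none :: rest)
    (hstep : ∀ d x r, L = d ++ x :: r → Runs (f x)
      ((S d (x :: r)).set k (r.map some ++ none :: rest)) (S (d ++ [x]) r) t) :
    Runs (bits k f) (S [] L) ((S L []).set k rest) (L.length * (t + 1) + 1) := by
  refine (Runs.loop_items S L t (fun d x r h => ?_) (by rw [hk]; rfl)).to ?_ le_rfl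
  · rw [hk]
    exact ⟨rfl, hstep d x r h⟩
  · rw [hk]
    rfl

/-- Move the stack `a` onto the stack `b`, which reverses the order. -/
def move (a b : Reg) : RegProg := drain a fun x => push b x

/-- Move the stack `a` onto both of the stacks `b` and `c`. -/
def move₂ (a b c : Reg) : RegProg := drain a fun x => push b x ;; push c x

/-- Empty the stack `a`. -/
def clear (a : Reg) : RegProg := drain a fun _ => skip

theorem Runs.move {a b : Reg} (hab : a ≠ b) (s : Stacks) :
    Runs (move a b) s ((s.set a []).set b ((s.get a).reverse ++ s.get b))
      ((s.get a).length * 2 + 1) := by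
  have h := Runs.drain (k := a) (f := fun x => StackProg.push b x)
    (fun d r => (s.set a r).set b (d.reverse ++ s.get b)) (s.get a) 1
    (fun d r => by rw [Stacks.get_set_of_ne hab, Stacks.get_set_self])
    (fun d x r => (Runs.push _ _ _).to (by
      rw [Stacks.set_comm hab.symm]; simp) le_rfl)
  unfold RegProg.move
  simpa using h

theorem Runs.move₂ {a b c : Reg} (hab : a ≠ b) (hac : a ≠ c) (hbc : b ≠ c) (s : Stacks) :
    Runs (move₂ a b c) s (((s.set a []).set b ((s.get a).reverse ++ s.get b)).set c
      ((s.get a).reverse ++ s.get c)) ((s.get a).length * 3 + 1) := by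
  have h := Runs.drain (k := a) (f := fun x => StackProg.push b x ;; StackProg.push c x)
    (fun d r => ((s.set a r).set b (d.reverse ++ s.get b)).set c (d.reverse ++ s.get c))
    (s.get a) 2
    (fun d r => by rw [Stacks.get_set_of_ne hac, Stacks.get_set_of_ne hab, Stacks.get_set_self])
    (fun d x r => ((Runs.push _ _ _).seq (Runs.push _ _ _)).to (by
      rw [Stacks.set_comm hac.symm, Stacks.set_comm hab.symm, Stacks.set_comm hbc.symm]
      simp [Stacks.get_set_of_ne hbc]) le_rfl)
  unfold RegProg.move₂
  simpa using h

theorem Runs.clear (a : Reg) (s : Stacks) :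
    Runs (clear a) s (s.set a []) ((s.get a).length * 2 + 1) := by
  have h := Runs.drain (k := a) (f := fun _ => StackProg.skip) (fun _ r => s.set a r) (s.get a) 1
    (fun d r => by rw [Stacks.get_set_self])
    (fun d x r => (Runs.skip _).to (by simp) le_rfl)
  unfold RegProg.clear
  simpa using h

/-! ### Marking vertices -/

/-- `markLeaf ℓ V M` adds to the set `M` the first `ℓ` elements of the set `V`, where the sets are
given by their characteristic vectors. -/
def markLeaf : ℕ → List Bool → List Bool → List Bool
  | _, [], _ => []
  | _, _ :: _, [] => []
  | ℓ, false :: V, m :: M => m :: markLeaf ℓ V M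
  | 0, true :: V, m :: M => m :: markLeaf 0 V M
  | ℓ + 1, true :: V, _ :: M => true :: markLeaf ℓ V M

/-- The elements of the set `V` at which the row `r` has the entry `b`. -/
def refine (b : Bool) (V r : List Bool) : List Bool :=
  List.zipWith (fun x y => x && (y == b)) V r

/-- `mark rows ℓ j V M` adds to `M`, for each set that arises from `V` by prescribing the entries in
at most `j` of the given rows, the first `ℓ` elements of this set. -/
def mark (rows : List (List Bool)) (ℓ : ℕ) : ℕ → List Bool → List Bool → List Bool
  | 0, V, M => markLeaf ℓ V M
  | j + 1, V, M => rows.foldl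
      (fun M r => mark rows ℓ j (refine false V r) (mark rows ℓ j (refine true V r) M))
      (mark rows ℓ j V M)

@[simp]
theorem length_markLeaf : ∀ (ℓ : ℕ) (V M : List Bool), M.length = V.length →
    (markLeaf ℓ V M).length = V.length
  | _, [], _, _ => by simp [markLeaf]
  | _, _ :: _, [], h => by simp at h
  | ℓ, false :: V, m :: M, h => by
    simp only [List.length_cons, Nat.add_right_cancel_iff] at h
    simp [markLeaf, length_markLeaf ℓ V M h]
  | 0, true :: V, m :: M, h => by
    simp only [List.length_cons, Nat.add_right_cancel_iff] at h
    simp [markLeaf, length_markLeaf 0 V M h]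
  | ℓ + 1, true :: V, m :: M, h => by
    simp only [List.length_cons, Nat.add_right_cancel_iff] at h
    simp [markLeaf, length_markLeaf ℓ V M h]

theorem length_refine {b : Bool} {V r : List Bool} (h : r.length = V.length) :
    (refine b V r).length = V.length := by
  simp [refine, h]

theorem length_mark {rows : List (List Bool)} {ℓ n : ℕ} (hrows : ∀ r ∈ rows, r.length = n) :
    ∀ (j : ℕ) (V M : List Bool), V.length = n → M.length = n → (mark rows ℓ j V M).length = n
  | 0, V, M, hV, hM => by rw [mark, length_markLeaf _ _ _ (hM.trans hV.symm), hV]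
  | j + 1, V, M, hV, hM => by
    rw [mark]
    refine List.foldlRecOn (motive := fun M : List Bool => M.length = n) rows _ (length_mark hrows j V M hV hM) fun M' hM' r hr => ?_
    have hr' := (hrows r hr).trans hV.symm
    exact length_mark hrows j _ _ ((length_refine hr').trans hV)
      (length_mark hrows j _ _ ((length_refine hr').trans hV) hM')

/-! ### The marking program -/

/-- Pop a candidate set and mark its first elements. -/
def leaf : RegProg :=
  bits .frames (fun b => if b then
      case .lim fun o => o.elim
        (case .mask fun m => m.elim skip (push .t1))
        (fun _ => push .t2 (some true) ;; case .mask fun _ => push .t1 (some true))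
    else case .mask fun m => m.elim skip (push .t1)) ;;
  move .t1 .mask ;; move .t2 .lim

/-- Duplicate the topmost candidate set. -/
def dup : RegProg :=
  bits .frames (fun b => push .t1 (some b) ;; push .t2 (some b)) ;;
  push .frames none ;; move .t1 .frames ;; push .frames none ;; move .t2 .frames

/-- Pop a row, and push the two parts into which it splits the topmost candidate set. -/
def split : RegProg :=
  bits .iter (fun b => case .frames fun a => a.elim skip fun a => a.elim skip fun a =>
    push .t1 (some a) ;; push .t2 (some (a && (b == false))) ;;
      push .t3 (some (a && (b == true)))) ;;
  move .t1 .frames ;; push .frames none ;; move .t2 .frames ;; push .frames none ;;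
  move .t3 .frames

/-- Pop the topmost candidate set and mark vertices as described by `mark`. -/
def search : ℕ → RegProg
  | 0 => leaf
  | j + 1 => dup ;; search j ;; push .iter none ;; move .rows .t1 ;; move₂ .t1 .rows .iter ;;
      loop .iter isBit (fun _ => split ;; search j ;; search j) ;; bits .frames fun _ => skip

/-- A bound on the running time of `search`, in terms of a bound on the lengths of all the lists
involved. -/
noncomputable def searchTime : ℕ → Polynomial ℕ
  | 0 => 10 * Polynomial.X + 3
  | j + 1 => 14 * Polynomial.X + 12 + searchTime j +
      Polynomial.X * (11 * Polynomial.X + 7 + 2 * searchTime j)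

theorem runs_leaf_loop (s : Stacks) (F : List (Option Bool)) : ∀ (V M : List Bool) (ℓ : ℕ)
    (T₁ T₂ : List (Option Bool)), M.length = V.length → ∃ j ≤ ℓ,
    Runs (bits .frames (fun b => if b then
        case .lim fun o => o.elim
          (case .mask fun m => m.elim skip (push .t1))
          (fun _ => push .t2 (some true) ;; case .mask fun _ => push .t1 (some true))
      else case .mask fun m => m.elim skip (push .t1)))
      { s with
        frames := V.map some ++ none :: F, mask := M.map some
        lim := List.replicate ℓ (some true), t1 := T₁, t2 := T₂ }
      { s with
        frames := F, mask := [], lim := List.replicate (ℓ - j) (some true)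
        t1 := ((markLeaf ℓ V M).map some).reverse ++ T₁
        t2 := List.replicate j (some true) ++ T₂ } (V.length * 6 + 1)
  | [], [], ℓ, T₁, T₂, h =>
    ⟨0, Nat.zero_le _, (Runs.loop_exit rfl).to (by simp [Stacks.get, Stacks.set, markLeaf]) (by simp)⟩
  | [], _ :: _, _, _, _, h => by simp at h
  | _ :: _, [], _, _, _, h => by simp at h
  | false :: V, m :: M, ℓ, T₁, T₂, h => by
    simp only [List.length_cons, Nat.add_right_cancel_iff] at h
    obtain ⟨j, hj, hr⟩ := runs_leaf_loop s F V M ℓ (some m :: T₁) T₂ h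
    refine ⟨j, hj, ((Runs.loop_step (t₁ := 2) (by rfl) ?_ hr).to (by simp [markLeaf]) ?_)⟩
    · exact Runs.case (Runs.push _ _ _)
    · simp only [List.length_cons]
      omega
  | true :: V, m :: M, 0, T₁, T₂, h => by
    simp only [List.length_cons, Nat.add_right_cancel_iff] at h
    obtain ⟨j, hj, hr⟩ := runs_leaf_loop s F V M 0 (some m :: T₁) T₂ h
    refine ⟨j, hj, ((Runs.loop_step (t₁ := 3) (by rfl) ?_ hr).to (by simp [markLeaf]) ?_)⟩
    · exact Runs.case (Runs.case (Runs.push _ _ _))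
    · simp only [List.length_cons]
      omega
  | true :: V, m :: M, ℓ + 1, T₁, T₂, h => by
    simp only [List.length_cons, Nat.add_right_cancel_iff] at h
    obtain ⟨j, hj, hr⟩ := runs_leaf_loop s F V M ℓ (some true :: T₁) (some true :: T₂) h
    refine ⟨j + 1, by omega, ((Runs.loop_step (t₁ := 4) (by rfl) ?_ hr).to ?_ ?_)⟩
    · exact Runs.case (((Runs.push _ _ _).seq (Runs.case (Runs.push _ _ _))).to rfl (by omega))
    · simp [markLeaf, List.replicate_succ', List.append_assoc]
    · simp only [List.length_cons]
      omega

theorem runs_leaf (s : Stacks) (F : List (Option Bool)) (V M : List Bool) (ℓ : ℕ)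
    (h : M.length = V.length) :
    Runs leaf
      { s with
        frames := V.map some ++ none :: F, mask := M.map some
        lim := List.replicate ℓ (some true), t1 := [], t2 := [] }
      { s with
        frames := F, mask := (markLeaf ℓ V M).map some
        lim := List.replicate ℓ (some true), t1 := [], t2 := [] } (V.length * 8 + 2 * ℓ + 3) := by
  obtain ⟨j, hj, hr⟩ := runs_leaf_loop s F V M ℓ [] [] h
  refine (hr.seq ((Runs.move (by decide) _).seq (Runs.move (by decide) _))).to ?_ ?_
  · simp [Stacks.get, Stacks.set, hj]
  · simp [Stacks.get, Stacks.set, h]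
    omega

theorem runs_dup (s : Stacks) (F : List (Option Bool)) (V : List Bool) :
    Runs dup { s with frames := V.map some ++ none :: F, t1 := [], t2 := [] }
      { s with
        frames := V.map some ++ none :: (V.map some ++ none :: F), t1 := [], t2 := [] }
      (V.length * 7 + 5) := by
  have h := Runs.bits (k := .frames)
    (f := fun b => StackProg.push .t1 (some b) ;; StackProg.push .t2 (some b))
    (fun d r => { s with
      frames := r.map some ++ none :: F, t1 := (d.map some).reverse, t2 := (d.map some).reverse })
    V F 2 (fun d r => rfl)
    (fun d x r _ => ((Runs.push _ _ _).seq (Runs.push _ _ _)).to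
      (by simp [Stacks.get, Stacks.set]) le_rfl)
  refine (h.seq ((Runs.push _ _ _).seq ((Runs.move (by decide) _).seq ((Runs.push _ _ _).seq
    (Runs.move (by decide) _))))).to ?_ ?_
  · simp [Stacks.get, Stacks.set]
  · simp [Stacks.get, Stacks.set]
    omega

theorem runs_split (s : Stacks) (F W : List (Option Bool)) (V r : List Bool)
    (hr : r.length = V.length) :
    Runs split
      { s with
        frames := V.map some ++ none :: F, iter := r.map some ++ none :: W
        t1 := [], t2 := [], t3 := [] }
      { s with
        frames := (refine true V r).map some ++ none ::
          ((refine false V r).map some ++ none :: (V.map some ++ none :: F))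
        iter := W, t1 := [], t2 := [], t3 := [] }
      (V.length * 11 + 6) := by
  have h : ∀ (V r : List Bool), r.length = V.length → ∀ T₁ T₂ T₃ : List (Option Bool),
      Runs (bits .iter (fun b => case .frames fun a => a.elim skip fun a => a.elim skip fun a =>
        StackProg.push .t1 (some a) ;; StackProg.push .t2 (some (a && (b == false))) ;;
          StackProg.push .t3 (some (a && (b == true)))))
      { s with
        frames := V.map some ++ none :: F, iter := r.map some ++ none :: W
        t1 := T₁, t2 := T₂, t3 := T₃ }
      { s with
        frames := none :: F, iter := W
        t1 := (V.map some).reverse ++ T₁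
        t2 := ((refine false V r).map some).reverse ++ T₂
        t3 := ((refine true V r).map some).reverse ++ T₃ } (V.length * 5 + 1) := by
    intro V
    induction V with
    | nil =>
      intro r hr T₁ T₂ T₃
      obtain rfl : r = [] := List.eq_nil_of_length_eq_zero hr
      exact (Runs.loop_exit rfl).to (by simp [Stacks.get, Stacks.set, refine]) (by simp)
    | cons a V ih =>
      intro r hr T₁ T₂ T₃
      cases r with
      | nil => simp at hr
      | cons b r =>
        simp only [List.length_cons, Nat.add_right_cancel_iff] at hr
        refine (Runs.loop_step (by rfl) (Runs.case ((Runs.push _ _ _).seq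
          ((Runs.push _ _ _).seq (Runs.push _ _ _)))) (ih r hr (some a :: T₁)
            (some (a && (b == false)) :: T₂) (some (a && (b == true)) :: T₃))).to ?_ ?_
        · simp [refine]
        · simp only [List.length_cons]
          omega
  refine ((h V r hr [] [] []).seq ((Runs.move (by decide) _).seq ((Runs.push _ _ _).seq
    ((Runs.move (by decide) _).seq ((Runs.push _ _ _).seq (Runs.move (by decide) _)))))).to ?_ ?_
  · simp [Stacks.get, Stacks.set]
  · simp [Stacks.get, Stacks.set, length_refine hr]
    omega

/-- The encoding of a list of rows, each preceded by the bit `1`. -/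
def encodeRows (L : List (List Bool)) : List (Option Bool) :=
  L.flatMap fun r => some true :: (r.map some ++ [none])

theorem runs_search {rows : List (List Bool)} {ℓ n N : ℕ} (hrows : ∀ r ∈ rows, r.length = n)
    (hn : n ≤ N) (hℓ : ℓ ≤ N) (hN : rows.length ≤ N) (hN' : (encodeRows rows).length ≤ N) :
    ∀ (j : ℕ) (s : Stacks) (F W : List (Option Bool)) (V M : List Bool),
      V.length = n → M.length = n →
      Runs (search j)
        { s with
          frames := V.map some ++ none :: F, mask := M.map some, iter := W
          lim := List.replicate ℓ (some true), rows := encodeRows rows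
          t1 := [], t2 := [], t3 := [] }
        { s with
          frames := F, mask := (mark rows ℓ j V M).map some, iter := W
          lim := List.replicate ℓ (some true), rows := encodeRows rows
          t1 := [], t2 := [], t3 := [] } ((searchTime j).eval N)
  | 0, s, F, W, V, M, hV, hM => by
    refine (runs_leaf { s with rows := encodeRows rows, iter := W, t3 := [] } F V M ℓ
      (hM.trans hV.symm)).to rfl ?_
    simp [searchTime]
    omega
  | j + 1, s, F, W, V, M, hV, hM => by
    have ih := runs_search hrows hn hℓ hN hN' j
    have hdup := runs_dup { s with
      mask := M.map some, iter := W, lim := List.replicate ℓ (some true)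
      rows := encodeRows rows, t3 := [] } F V
    have hfirst := ih s (V.map some ++ none :: F) W V M hV hM
    have hlen : ∀ (L : List (List Bool)), (∀ r ∈ L, r ∈ rows) → (L.foldl (fun M r =>
        mark rows ℓ j (refine false V r) (mark rows ℓ j (refine true V r) M))
        (mark rows ℓ j V M)).length = n := by
      refine fun L hL => List.foldlRecOn (motive := fun M : List Bool => M.length = n) L _
        (length_mark hrows j V M hV hM) fun M' hM' r hr => ?_
      have hr' := (hrows r (hL r hr)).trans hV.symm
      exact length_mark hrows j _ _ ((length_refine hr').trans hV)
        (length_mark hrows j _ _ ((length_refine hr').trans hV) hM')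
    have hloop := Runs.loop_items (k := .iter) (c := isBit)
      (f := fun _ => split ;; search j ;; search j)
      (fun d r => { s with
        frames := V.map some ++ none :: F
        mask := (d.foldl (fun M r =>
          mark rows ℓ j (refine false V r) (mark rows ℓ j (refine true V r) M))
          (mark rows ℓ j V M)).map some
        iter := encodeRows r ++ none :: W
        lim := List.replicate ℓ (some true), rows := encodeRows rows
        t1 := [], t2 := [], t3 := [] })
      rows (11 * N + 6 + 2 * (searchTime j).eval N)
      (by
        intro d x r hL
        refine ⟨rfl, ?_⟩
        have hx := (hrows x (by simp [hL])).trans hV.symm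
        have hd := hlen d fun r' h' => by simp [hL, h']
        rw [List.foldl_append, List.foldl_cons, List.foldl_nil]
        generalize d.foldl _ _ = M' at hd
        refine Runs.of_eq ?_ (((runs_split { s with
          mask := M'.map some, lim := List.replicate ℓ (some true)
          rows := encodeRows rows } F (encodeRows r ++ none :: W) V x hx).seq
          ((ih s _ (encodeRows r ++ none :: W) (refine true V x) M'
            ((length_refine hx).trans hV) hd).seq
          (ih s _ (encodeRows r ++ none :: W) (refine false V x) _
            ((length_refine hx).trans hV)
            (length_mark hrows j _ _ ((length_refine hx).trans hV) hd)))).to rfl ?_)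
        · simp [Stacks.set, Stacks.get, encodeRows]
        · rw [hV]
          omega)
      rfl
    have hskip := Runs.bits (k := .frames) (f := fun _ => StackProg.skip)
      (fun d r => { s with
        frames := r.map some ++ none :: F
        mask := (mark rows ℓ (j + 1) V M).map some
        iter := W
        lim := List.replicate ℓ (some true), rows := encodeRows rows
        t1 := [], t2 := [], t3 := [] })
      V F 1 (fun d r => rfl) (fun d x r _ => Runs.skip _)
    refine (hdup.seq (hfirst.seq ((Runs.push _ _ _).seq ((Runs.move (by decide) _).seq
      (((Runs.move₂ (by decide) (by decide) (by decide) _).to ?_ le_rfl).seq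
        (hloop.seq hskip)))))).to rfl ?_
    · simp [Stacks.get, Stacks.set]
    · simp [Stacks.get, Stacks.set, searchTime]
      have := Nat.mul_le_mul_right (11 * N + 7 + 2 * (searchTime j).eval N) hN
      have e : 11 * N + 6 + 2 * Polynomial.eval N (searchTime j) + 1 =
        11 * N + 7 + 2 * (searchTime j).eval N := by omega
      rw [e]
      omega

/-! ### Reading the instance -/

/-- The encoding of a graph with a vertex set, given for each vertex by the membership bit and the
row of the adjacency matrix. -/
def encodeGraph (R : List (Bool × List Bool)) : List (Option Bool) :=
  R.flatMap fun r => some r.1 :: (r.2.map some ++ [none])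

/-- The rows of the vertices whose membership bit is set. -/
def coverRows (R : List (Bool × List Bool)) : List (List Bool) :=
  (R.filter (·.1)).map (·.2)

/-- Pop the remainder of the row of a vertex in the cover, and copy the row. -/
def scanCoverRow (useX : Bool) : RegProg :=
  push .t3 (some useX) ;; push .cnt (some true) ;; push .t2 (some true) ;;
    bits .inp (fun b => push .t1 (some b) ;; push .t2 (some b)) ;; push .t1 none ;; push .t2 none

/-- Pop the remainder of the row of a vertex outside the cover. -/
def scanOtherRow : RegProg :=
  push .t3 (some false) ;; bits .inp (fun b => push .t1 (some b)) ;; push .t1 none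

/-- Copy the rows of the cover, count them, and set up the initial mask and the initial candidate
set: the cover and its complement if `useX` is set, and no vertices and all vertices otherwise. -/
def scan (useX : Bool) : RegProg :=
  drain .inp (fun a => push .t1 a ;; bif a.getD false then scanCoverRow useX else scanOtherRow) ;;
  move .t1 .inp ;; move .t2 .rows ;; push .frames none ;;
  drain .t3 (fun o => o.elim skip fun b => push .mask (some b) ;; push .frames (some !b)) ;;
  push .cnt (some true)

theorem runs_scanCoverRow (useX : Bool) (s : Stacks) (v : List Bool)
    (I C T₁ T₂ T₃ : List (Option Bool)) :
    Runs (scanCoverRow useX)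
      { s with inp := v.map some ++ none :: I, cnt := C, t1 := T₁, t2 := T₂, t3 := T₃ }
      { s with
        inp := I, cnt := some true :: C, t1 := none :: ((v.map some).reverse ++ T₁)
        t2 := none :: ((v.map some).reverse ++ some true :: T₂), t3 := some useX :: T₃ }
      (v.length * 3 + 6) := by
  have h := Runs.bits (k := .inp)
    (f := fun b => StackProg.push .t1 (some b) ;; StackProg.push .t2 (some b))
    (fun d r => { s with
      inp := r.map some ++ none :: I, cnt := some true :: C
      t1 := (d.map some).reverse ++ T₁, t2 := (d.map some).reverse ++ some true :: T₂
      t3 := some useX :: T₃ }) v I 2 (fun _ _ => rfl)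
    (fun d x r _ => ((Runs.push _ _ _).seq (Runs.push _ _ _)).to
      (by simp [Stacks.get, Stacks.set]) le_rfl)
  exact ((Runs.push _ _ _).seq ((Runs.push _ _ _).seq ((Runs.push _ _ _).seq
    (h.seq ((Runs.push _ _ _).seq (Runs.push _ _ _)))))).to rfl (by omega)

theorem runs_scanOtherRow (s : Stacks) (v : List Bool) (I T₁ T₃ : List (Option Bool)) :
    Runs scanOtherRow
      { s with inp := v.map some ++ none :: I, t1 := T₁, t3 := T₃ }
      { s with inp := I, t1 := none :: ((v.map some).reverse ++ T₁), t3 := some false :: T₃ }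
      (v.length * 2 + 3) := by
  have h := Runs.bits (k := .inp) (f := fun b => StackProg.push .t1 (some b))
    (fun d r => { s with
      inp := r.map some ++ none :: I
      t1 := (d.map some).reverse ++ T₁, t3 := some false :: T₃ }) v I 1 (fun _ _ => rfl)
    (fun d x r _ => (Runs.push _ _ _).to (by simp [Stacks.get, Stacks.set]) le_rfl)
  exact ((Runs.push _ _ _).seq (h.seq (Runs.push _ _ _))).to rfl (by omega)

theorem runs_scan (useX : Bool) (s : Stacks) (n : ℕ) (R : List (Bool × List Bool))
    (hR : ∀ r ∈ R, r.2.length = n) :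
    Runs (scan useX)
      { s with
        inp := encodeGraph R, rows := [], cnt := [], mask := [], frames := []
        t1 := [], t2 := [], t3 := [] }
      { s with
        inp := encodeGraph R, rows := encodeRows (coverRows R)
        cnt := List.replicate ((coverRows R).length + 1) (some true)
        mask := (R.map (·.1 && useX)).map some
        frames := ((R.map (·.1 && useX)).map not).map some ++ none :: []
        t1 := [], t2 := [], t3 := [] }
      (R.length * (3 * n + 11) + (encodeGraph R).length * 2 +
        (encodeRows (coverRows R)).length * 2 + 6) := by
  have h₁ := Runs.loop_items (k := .inp) (c := Option.isSome)
    (f := fun o => o.elim StackProg.skip fun a =>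
      StackProg.push .t1 a ;; bif a.getD false then scanCoverRow useX else scanOtherRow)
    (fun d r => { s with
      inp := encodeGraph r, rows := []
      cnt := List.replicate (coverRows d).length (some true)
      mask := [], frames := [], t1 := (encodeGraph d).reverse
      t2 := (encodeRows (coverRows d)).reverse
      t3 := ((d.map (·.1 && useX)).reverse).map some }) R (3 * n + 7) (by
      rintro d ⟨b, v⟩ r hL
      have hv : v.length = n := hR (b, v) (by simp [hL])
      have e : encodeGraph ((b, v) :: r) = some b :: (v.map some ++ none :: encodeGraph r) := by
        simp [encodeGraph]
      rw [e]
      refine ⟨rfl, ?_⟩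
      cases b with
      | true =>
        exact ((Runs.push _ _ _).seq (runs_scanCoverRow useX { s with
          rows := [], mask := [], frames := [] } v _ _ _ _ _)).to
          (by simp [Stacks.get, Stacks.set, encodeGraph, encodeRows, coverRows,
            List.replicate_succ]) (by omega)
      | false =>
        exact ((Runs.push _ _ _).seq (runs_scanOtherRow { s with
          rows := [], mask := [], frames := []
          cnt := List.replicate (coverRows d).length (some true)
          t2 := (encodeRows (coverRows d)).reverse } v _ _ _)).to
          (by simp [Stacks.get, Stacks.set, encodeGraph, coverRows]) (by omega)) rfl
  have h₂ := Runs.loop_items (k := .t3) (c := Option.isSome)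
    (f := fun o => o.elim StackProg.skip fun o => o.elim StackProg.skip fun b =>
      StackProg.push .mask (some b) ;; StackProg.push .frames (some !b))
    (fun d r => { s with
      inp := encodeGraph R, rows := encodeRows (coverRows R)
      cnt := List.replicate (coverRows R).length (some true)
      mask := (d.map some).reverse, frames := ((d.map not).map some).reverse ++ none :: []
      t1 := [], t2 := [], t3 := r.map some }) ((R.map (·.1 && useX)).reverse) 2
    (fun d x r _ => ⟨rfl, ((Runs.push _ _ _).seq (Runs.push _ _ _)).to
      (by simp [Stacks.get, Stacks.set]) le_rfl⟩) rfl
  refine (h₁.seq ((Runs.move (by decide) _).seq ((Runs.move (by decide) _).seq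
    ((Runs.push _ _ _).seq ((Runs.of_eq ?_ h₂).seq (Runs.push _ _ _)))))).to ?_ ?_
  · simp [Stacks.get, Stacks.set, show encodeGraph [] = [] from rfl]
  · simp [Stacks.get, Stacks.set, List.replicate_succ]
  · simp [Stacks.get, Stacks.set]
    ring_nf
    omega

/-! ### The number of vertices to keep for each candidate set -/

/-- Push `n` symbols onto the stack `lim`. -/
def pushMany : ℕ → RegProg
  | 0 => skip
  | n + 1 => push .lim (some true) ;; pushMany n

/-- Multiply the unary numbers on `lim` and `cnt`. -/
def mul : RegProg :=
  drain .lim (fun _ => move₂ .cnt .t1 .t2 ;; move .t1 .cnt) ;; move .t2 .lim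

/-- Compute `C * m ^ d` in unary, where `m` is the unary number on `cnt`. -/
def limit (C : ℕ) : ℕ → RegProg
  | 0 => pushMany C
  | d + 1 => limit C d ;; mul

/-- The running time of `limit`. -/
noncomputable def limitTime (C : ℕ) : ℕ → Polynomial ℕ
  | 0 => Polynomial.C (C + 1)
  | d + 1 => limitTime C d + (Polynomial.C C * Polynomial.X ^ d * (7 * Polynomial.X + 3) + 2)

theorem runs_pushMany (s : Stacks) : ∀ n L, Runs (pushMany n) { s with lim := L }
    { s with lim := List.replicate n (some true) ++ L } (n + 1)
  | 0, L => (Runs.skip _).to rfl le_rfl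
  | n + 1, L => ((Runs.push _ _ _).seq (runs_pushMany s n (some true :: L))).to
      (by simp [List.replicate_succ']) (by omega)

theorem runs_mul (s : Stacks) (ℓ m : ℕ) :
    Runs mul
      { s with
        lim := List.replicate ℓ (some true), cnt := List.replicate m (some true)
        t1 := [], t2 := [] }
      { s with
        lim := List.replicate (ℓ * m) (some true), cnt := List.replicate m (some true)
        t1 := [], t2 := [] }
      (ℓ * (7 * m + 3) + 2) := by
  have h := Runs.drain (k := .lim) (f := fun _ => RegProg.move₂ .cnt .t1 .t2 ;; RegProg.move .t1 .cnt)
    (fun d r => { s with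
      lim := r, cnt := List.replicate m (some true), t1 := []
      t2 := List.replicate (d.length * m) (some true) })
    (List.replicate ℓ (some true)) (5 * m + 2) (fun _ _ => rfl)
    (fun d x r => ((Runs.move₂ (by decide) (by decide) (by decide) _).seq
      (Runs.move (by decide) _)).to (by
        simp [Stacks.get, Stacks.set, Nat.add_mul, Nat.add_comm (d.length * m)]) (by
        simp [Stacks.get, Stacks.set]
        omega))
  refine ((Runs.of_eq ?_ h).seq (Runs.move (by decide) _)).to ?_ ?_
  · simp
  · simp [Stacks.get, Stacks.set]
  · simp [Stacks.get]
    ring_nf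
    omega

theorem runs_limit (s : Stacks) (C m : ℕ) : ∀ d, Runs (limit C d)
    { s with lim := [], cnt := List.replicate m (some true), t1 := [], t2 := [] }
    { s with
      lim := List.replicate (C * m ^ d) (some true), cnt := List.replicate m (some true)
      t1 := [], t2 := [] } ((limitTime C d).eval m)
  | 0 => (runs_pushMany { s with cnt := List.replicate m (some true), t1 := [], t2 := [] } C []).to
      (by simp) (by simp [limitTime])
  | d + 1 => ((runs_limit s C m d).seq (runs_mul s _ m)).to (by simp [pow_succ, mul_assoc])
      (by simp [limitTime])

/-! ### Writing the reduced instance -/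

/-- Replace a binary number with more than `m` digits by the number with `m` digits `1`. -/
def truncate (m : ℕ) (l : List Bool) : List Bool :=
  if l.length ≤ m then l else List.replicate m true

/-- The entries of the list `v` at the positions where `M` is true. -/
def pick {α : Type} (M : List Bool) (v : List α) : List α :=
  ((M.zip v).filter (·.1)).map (·.2)

/-- The rows and columns of `R` at the positions where `M` is true. -/
def restrict (M : List Bool) (R : List (Bool × List Bool)) : List (Bool × List Bool) :=
  (pick M R).map fun r => (r.1, pick M r.2)

/-- Write the truncated target value. -/
def writeTarget : RegProg :=
  move .kb .t1 ;;
  drain .mask (fun o => push .t2 o ;; bif o.getD false then push .cnt (some true) else skip) ;;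
  move .t2 .mask ;; push .cnt (some true) ;;
  drain .t1 (fun a => case .cnt fun o => o.elim (push .t3 (some true))
    fun _ => push .out a ;; push .t2 (some true)) ;;
  case .t3 (fun o => o.elim skip fun _ => clear .out ;; move .t2 .out) ;;
  clear .t2 ;; clear .t3 ;; clear .cnt ;; push .out none

/-- Write the restriction of a row. -/
def writeRow : RegProg :=
  case .inp (fun o => o.elim skip (push .out)) ;;
  drain .mask (fun o => push .t1 o ;; case .inp fun a =>
    bif o.getD false then a.elim skip (push .out) else skip) ;;
  move .t1 .mask ;; case .inp (fun _ => skip) ;; push .out none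

/-- Write the restriction of the graph to the kept vertices. -/
def writeRows : RegProg :=
  move .mask .t1 ;; move₂ .t1 .mask .t2 ;;
  drain .t2 fun o => bif o.getD false then writeRow else bits .inp fun _ => skip

/-- The copying loop of `writeTarget`, run on the digits `L` with the unary number `m` on `cnt`:
the digits beyond the first `m` are only counted. -/
theorem runs_writeTarget_copy (s : Stacks) (m : ℕ) (L : List (Option Bool)) :
    Runs (drain .t1 (fun a => case .cnt fun o => o.elim (push .t3 (some true))
        fun _ => push .out a ;; push .t2 (some true)))
      { s with
        t1 := L, cnt := List.replicate m (some true), t2 := [], t3 := [], out := [] }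
      { s with
        t1 := [], cnt := List.replicate (m - L.length) (some true)
        t2 := List.replicate (min m L.length) (some true)
        t3 := List.replicate (L.length - m) (some true), out := (L.take m).reverse }
      (L.length * 4 + 1) := by
  refine Runs.of_eq ?_ (Runs.drain (fun d r => { s with
    t1 := r, cnt := List.replicate (m - d.length) (some true)
    t2 := List.replicate (min m d.length) (some true)
    t3 := List.replicate (d.length - m) (some true), out := (d.take m).reverse }) L 3
    (fun _ _ => rfl) fun d x r => ?_)
  · simp
  · rcases Nat.lt_or_ge d.length m with h | h
    · obtain ⟨j, rfl⟩ := Nat.exists_eq_add_of_lt h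
      have e : d.length + j + 1 - d.length = j + 1 := by omega
      rw [e]
      refine (Runs.case ((Runs.push _ _ _).seq (Runs.push _ _ _))).to ?_ le_rfl
      simp [Stacks.get, Stacks.set, List.take_of_length_le,
        show d.length + j + 1 - (d.length + 1) = j by omega,
        show d.length - (d.length + j + 1) = 0 by omega,
        show d.length + 1 - (d.length + j + 1) = 0 by omega, List.replicate_succ,
        show d.length ≤ d.length + j + 1 by omega]
    · rw [Nat.sub_eq_zero_of_le h]
      refine (Runs.case (Runs.push _ _ _)).to ?_ (by omega)
      simp [Stacks.get, Stacks.set, List.take_append, h, Nat.sub_eq_zero_of_le h,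
        show m - (d.length + 1) = 0 by omega, show m ≤ d.length + 1 by omega,
        show d.length + 1 - m = (d.length - m) + 1 by omega, List.replicate_succ]

theorem runs_writeTarget (s : Stacks) (M l : List Bool) :
    Runs writeTarget
      { s with
        kb := (l.map some).reverse, mask := M.map some, cnt := []
        t1 := [], t2 := [], t3 := [], out := [] }
      { s with
        kb := [], mask := M.map some, cnt := [], t1 := [], t2 := [], t3 := []
        out := none :: ((truncate (M.count true + 1) l).map some).reverse }
      (M.length * 15 + l.length * 30 + 50) := by
  have h₁ := Runs.loop_items (k := .mask) (c := Option.isSome)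
    (f := fun o => o.elim StackProg.skip fun o => StackProg.push .t2 o ;;
      bif o.getD false then StackProg.push .cnt (some true) else StackProg.skip)
    (fun d r => { s with
      kb := [], mask := r.map some, cnt := List.replicate (d.count true) (some true)
      t1 := l.map some, t2 := (d.map some).reverse, t3 := [], out := [] }) M 2
    (fun d x r _ => by
      refine ⟨rfl, ?_⟩
      cases x
      · exact ((Runs.push _ _ _).seq (Runs.skip _)).to (by simp [Stacks.get, Stacks.set]) le_rfl
      · exact ((Runs.push _ _ _).seq (Runs.push _ _ _)).to
          (by simp [Stacks.get, Stacks.set, List.replicate_succ]) le_rfl) rfl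
  have h₂ := runs_writeTarget_copy { s with kb := [], mask := M.map some } (M.count true + 1)
    (l.map some)
  have hc : M.count true ≤ M.length := List.count_le_length
  have h₃ : Runs (case .t3 (fun o => o.elim skip fun _ => clear .out ;; move .t2 .out) ;;
      clear .t2 ;; clear .t3 ;; clear .cnt ;; push .out none)
      { s with
        kb := [], mask := M.map some
        cnt := List.replicate (M.count true + 1 - (l.map some).length) (some true), t1 := []
        t2 := List.replicate (min (M.count true + 1) (l.map some).length) (some true)
        t3 := List.replicate ((l.map some).length - (M.count true + 1)) (some true)
        out := ((l.map some).take (M.count true + 1)).reverse }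
      { s with
        kb := [], mask := M.map some, cnt := [], t1 := [], t2 := [], t3 := []
        out := none :: ((truncate (M.count true + 1) l).map some).reverse }
      (M.length * 4 + l.length * 8 + 20) := by
    rw [List.length_map]
    rcases Nat.lt_or_ge (M.count true + 1) l.length with h | h
    · obtain ⟨j, hj⟩ := Nat.exists_eq_add_of_lt h
      have e : l.length - (M.count true + 1) = j + 1 := by omega
      rw [e]
      refine ((Runs.case ((Runs.clear .out _).seq (Runs.move (by decide) _))).seq
        ((Runs.clear .t2 _).seq ((Runs.clear .t3 _).seq ((Runs.clear .cnt _).seq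
        (Runs.push .out none _))))).to ?_ ?_
      · simp [Stacks.get, Stacks.set, truncate, h.not_ge, h.le]
      · simp [Stacks.get, Stacks.set]
        omega
    · rw [Nat.sub_eq_zero_of_le h]
      refine ((Runs.case (Runs.skip _)).seq
        ((Runs.clear .t2 _).seq ((Runs.clear .t3 _).seq ((Runs.clear .cnt _).seq
        (Runs.push .out none _))))).to ?_ ?_
      · simp [Stacks.get, Stacks.set, truncate, h]
      · simp [Stacks.get, Stacks.set]
        omega
  refine ((Runs.move (by decide) _).seq ((Runs.of_eq ?_ h₁).seq ((Runs.move (by decide) _).seq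
    ((Runs.push _ _ _).seq ((Runs.of_eq ?_ h₂).seq h₃))))).to rfl ?_
  · simp [Stacks.get, Stacks.set]
  · simp [Stacks.get, Stacks.set, List.replicate_succ]
  · simp [Stacks.get, Stacks.set]
    omega

theorem runs_writeRow (s : Stacks) (b : Bool) (M v : List Bool) (hv : v.length = M.length)
    (I O : List (Option Bool)) :
    Runs writeRow
      { s with
        inp := some b :: (v.map some ++ none :: I), mask := M.map some, t1 := [], out := O }
      { s with
        inp := I, mask := M.map some, t1 := []
        out := none :: (((pick M v).map some).reverse ++ some b :: O) }
      (M.length * 6 + 7) := by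
  have h := Runs.loop_items (k := .mask) (c := Option.isSome)
    (f := fun o => o.elim StackProg.skip fun o => StackProg.push .t1 o ;; StackProg.case .inp fun a =>
      bif o.getD false then a.elim StackProg.skip (StackProg.push .out) else StackProg.skip)
    (fun d r => { s with
      inp := (r.map (·.2)).map some ++ none :: I, mask := (r.map (·.1)).map some
      t1 := ((d.map (·.1)).map some).reverse
      out := (((d.filter (·.1)).map (·.2)).map some).reverse ++ some b :: O }) (M.zip v) 3
    (fun d x r _ => by
      refine ⟨rfl, ?_⟩
      obtain ⟨x, y⟩ := x
      cases x
      · exact ((Runs.push _ _ _).seq (Runs.case (Runs.skip _))).to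
          (by simp [Stacks.get, Stacks.set]) le_rfl
      · exact ((Runs.push _ _ _).seq (Runs.case (Runs.push _ _ _))).to
          (by simp [Stacks.get, Stacks.set]) le_rfl) rfl
  have e₁ : (M.zip v).map (·.1) = M := List.map_fst_zip hv.ge
  have e₂ : (M.zip v).map (·.2) = v := List.map_snd_zip hv.le
  rw [e₁, e₂] at h
  refine ((Runs.case (Runs.push _ _ _)).seq (h.seq ((Runs.move (by decide) _).seq
    ((Runs.case (Runs.skip _)).seq (Runs.push _ _ _))))).to ?_ ?_
  · simp [Stacks.get, Stacks.set, pick]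
  · simp [Stacks.get, Stacks.set, hv]
    omega

theorem runs_writeRows (s : Stacks) (M : List Bool) (R : List (Bool × List Bool))
    (hM : R.length = M.length) (hR : ∀ r ∈ R, r.2.length = M.length) (O : List (Option Bool)) :
    Runs writeRows
      { s with inp := encodeGraph R, mask := M.map some, t1 := [], t2 := [], out := O }
      { s with
        inp := [], mask := M.map some, t1 := [], t2 := []
        out := (encodeGraph (restrict M R)).reverse ++ O }
      (M.length * (6 * M.length + 13) + 3) := by
  have h := Runs.loop_items (k := .t2) (c := Option.isSome)
    (f := fun o => o.elim StackProg.skip fun o =>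
      bif o.getD false then writeRow else bits .inp fun _ => StackProg.skip)
    (fun d r => { s with
      inp := encodeGraph (r.map (·.2)), mask := M.map some, t1 := []
      t2 := (r.map (·.1)).map some
      out := (encodeGraph (((d.filter (·.1)).map (·.2)).map fun r => (r.1, pick M r.2))).reverse
        ++ O }) (M.zip R) (6 * M.length + 7)
    (fun d x r hL => by
      refine ⟨rfl, ?_⟩
      obtain ⟨x, b, v⟩ := x
      have hmem : (x, b, v) ∈ M.zip R := by simp [hL]
      have hv : v.length = M.length := hR (b, v) (List.of_mem_zip hmem).2
      have e : encodeGraph (((x, b, v) :: r).map (·.2)) =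
          some b :: (v.map some ++ none :: encodeGraph (r.map (·.2))) := by
        simp [encodeGraph]
      rw [e]
      cases x
      · have h := Runs.bits (k := .inp) (f := fun _ => StackProg.skip)
          (fun _ r' => { s with
            inp := r'.map some ++ none :: encodeGraph (r.map (·.2)), mask := M.map some, t1 := []
            t2 := (r.map (·.1)).map some
            out := (encodeGraph (((d.filter (·.1)).map (·.2)).map
              fun r => (r.1, pick M r.2))).reverse ++ O }) (b :: v) (encodeGraph (r.map (·.2))) 1
          (fun _ _ => rfl) (fun _ _ _ _ => Runs.skip _)
        exact h.to (by simp [Stacks.set]) (by simp [hv]; omega)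
      · exact (runs_writeRow { s with t2 := (r.map (·.1)).map some } b M v hv _ _).to
          (by simp [encodeGraph]) (by omega)) rfl
  have e₁ : (M.zip R).map (·.1) = M := List.map_fst_zip hM.ge
  have e₂ : (M.zip R).map (·.2) = R := List.map_snd_zip hM.le
  rw [e₁, e₂] at h
  refine ((Runs.move (by decide) _).seq (((Runs.move₂ (by decide) (by decide) (by decide) _).to
    ?_ le_rfl).seq h)).to ?_ ?_
  · simp [Stacks.get, Stacks.set, encodeGraph]
  · simp [Stacks.get, Stacks.set, encodeGraph, restrict, pick]
  · simp [Stacks.get, Stacks.set, hM]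
    ring_nf
    omega

/-! ### The kernelization program -/

/-- The mask of the vertices that the kernelization keeps. -/
def keptMask (useX : Bool) (c C d : ℕ) (R : List (Bool × List Bool)) : List Bool :=
  mark (coverRows R) (C * ((coverRows R).length + 1) ^ d) c
    ((R.map (·.1 && useX)).map not) (R.map (·.1 && useX))

theorem length_keptMask (useX : Bool) (c C d : ℕ) {R : List (Bool × List Bool)}
    (hR : ∀ r ∈ R, r.2.length = R.length) : (keptMask useX c C d R).length = R.length := by
  refine length_mark (fun r hr => ?_) _ _ _ (by simp) (by simp)
  simp only [coverRows, List.mem_map, List.mem_filter] at hr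
  obtain ⟨r, ⟨hr, -⟩, rfl⟩ := hr
  exact hR r hr

/-- The kernelization program. -/
def kernelize (useX : Bool) (c C d : ℕ) : RegProg :=
  bits .inp (fun b => push .kb (some b)) ;; scan useX ;; limit C d ;; clear .cnt ;; search c ;;
    writeTarget ;; writeRows ;; clear .mask ;; clear .lim ;; clear .rows ;; move .out .inp

/-- A bound on the running time of `kernelize`. -/
noncomputable def kernelizeTime (c C d : ℕ) : Polynomial ℕ :=
  11 * Polynomial.X ^ 2 + 92 * Polynomial.X + 80 + (limitTime C d).comp (Polynomial.X + 1) +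
    (searchTime c).comp (Polynomial.X + Polynomial.C C * (Polynomial.X + 1) ^ d) +
    2 * (Polynomial.C C * (Polynomial.X + 1) ^ d)

theorem eval_monotone (q : Polynomial ℕ) : Monotone fun n => q.eval n := by
  intro m n h
  simp only [Polynomial.eval_eq_sum_range]
  gcongr

theorem length_encodeGraph_le {n : ℕ} : ∀ {R : List (Bool × List Bool)},
    (∀ r ∈ R, r.2.length ≤ n) → (encodeGraph R).length ≤ R.length * (n + 2)
  | [], _ => by simp [encodeGraph]
  | r :: R, h => by
    have h₁ := h r List.mem_cons_self
    have h₂ := length_encodeGraph_le (R := R) fun r' hr' => h r' (List.mem_cons_of_mem _ hr')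
    simp only [encodeGraph, List.flatMap_cons, List.length_append, List.length_cons,
      List.length_map, List.length_nil] at h₂ ⊢
    rw [Nat.add_mul]
    omega

theorem length_le_length_encodeGraph : ∀ R : List (Bool × List Bool),
    R.length ≤ (encodeGraph R).length
  | [] => by simp
  | r :: R => by
    have := length_le_length_encodeGraph R
    simp only [encodeGraph, List.flatMap_cons, List.length_append, List.length_cons,
      List.length_map, List.length_nil] at this ⊢
    omega

theorem length_encodeRows_coverRows_le : ∀ R : List (Bool × List Bool),
    (encodeRows (coverRows R)).length ≤ (encodeGraph R).length
  | [] => by simp [coverRows, encodeRows]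
  | (b, v) :: R => by
    have := length_encodeRows_coverRows_le R
    cases b
    · simp only [coverRows, encodeGraph, List.filter_cons, Bool.false_eq_true, if_false,
        List.flatMap_cons, List.length_append] at this ⊢
      omega
    · simp only [coverRows, encodeGraph, encodeRows, List.filter_cons, if_true, List.map_cons,
        List.flatMap_cons, List.length_append, List.length_cons, List.length_map] at this ⊢
      omega

theorem length_pick_le {α : Type} (M : List Bool) (v : List α) : (pick M v).length ≤ v.length := by
  rw [pick, List.length_map]
  refine (List.length_filter_le _ _).trans ?_
  rw [List.length_zip]
  exact min_le_right _ _

theorem length_truncate_le (m : ℕ) (l : List Bool) : (truncate m l).length ≤ l.length := by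
  unfold truncate
  split_ifs with h
  · exact le_rfl
  · simp
    omega

theorem runs_kernelize (useX : Bool) (c C d : ℕ) (l : List Bool) (R : List (Bool × List Bool))
    (hR : ∀ r ∈ R, r.2.length = R.length) :
    Runs (kernelize useX c C d)
      (Stacks.empty.set .inp (l.map some ++ none :: encodeGraph R))
      (Stacks.empty.set .inp
        ((truncate ((keptMask useX c C d R).count true + 1) l).map some ++ none ::
          encodeGraph (restrict (keptMask useX c C d R) R)))
      ((kernelizeTime c C d).eval (l.map some ++ none :: encodeGraph R).length) := by
  have hM := length_keptMask useX c C d hR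
  have hread := Runs.bits (k := .inp) (f := fun b => StackProg.push .kb (some b))
    (fun d r => { Stacks.empty with
      inp := r.map some ++ none :: encodeGraph R, kb := (d.map some).reverse }) l (encodeGraph R) 1
    (fun _ _ => rfl)
    (fun d x r _ => (Runs.push _ _ _).to (by simp [Stacks.get, Stacks.set, Stacks.empty]) le_rfl)
  have hscan := runs_scan useX { Stacks.empty with kb := (l.map some).reverse } R.length R hR
  set x := (coverRows R).length with hx
  set ℓ := C * (x + 1) ^ d with hℓ
  have hlim := runs_limit { Stacks.empty with
    inp := encodeGraph R, rows := encodeRows (coverRows R), kb := (l.map some).reverse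
    mask := (R.map (·.1 && useX)).map some
    frames := ((R.map (·.1 && useX)).map not).map some ++ none :: [] } C (x + 1) d
  set N := (l.map some ++ none :: encodeGraph R).length with hN
  have hlN : l.length + 1 + (encodeGraph R).length = N := by simp [hN]; omega
  have hRN : R.length + l.length + 1 ≤ N := by
    have := length_le_length_encodeGraph R
    omega
  have hxR : x ≤ R.length := by
    rw [hx, coverRows, List.length_map]
    exact List.length_filter_le _ _
  have hℓN : ℓ ≤ C * (N + 1) ^ d := by
    rw [hℓ]
    gcongr
    omega
  have hrows : (encodeRows (coverRows R)).length ≤ N :=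
    (length_encodeRows_coverRows_le R).trans (by omega)
  have hsearch := runs_search (rows := coverRows R) (ℓ := ℓ) (n := R.length)
    (N := N + C * (N + 1) ^ d) (fun r hr => by
      simp only [coverRows, List.mem_map, List.mem_filter] at hr
      obtain ⟨r, ⟨hr, -⟩, rfl⟩ := hr
      exact hR r hr) (by omega) (by omega) (by omega) (by omega) c
    { Stacks.empty with inp := encodeGraph R, kb := (l.map some).reverse } [] []
    ((R.map (·.1 && useX)).map not) (R.map (·.1 && useX)) (by simp) (by simp)
  change Runs _ _ { Stacks.empty with
    inp := encodeGraph R, kb := (l.map some).reverse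
    frames := [], mask := (keptMask useX c C d R).map some, iter := []
    lim := List.replicate ℓ (some true), rows := encodeRows (coverRows R)
    t1 := [], t2 := [], t3 := [] } _ at hsearch
  generalize keptMask useX c C d R = M at hM hsearch ⊢
  have htarget := runs_writeTarget { Stacks.empty with
    inp := encodeGraph R, lim := List.replicate ℓ (some true)
    rows := encodeRows (coverRows R) } M l
  have hwrite := runs_writeRows { Stacks.empty with
    lim := List.replicate ℓ (some true), rows := encodeRows (coverRows R) } M R hM.symm
    (fun r hr => (hR r hr).trans hM.symm)
    (none :: ((truncate (M.count true + 1) l).map some).reverse)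
  have hout : (encodeGraph (restrict M R)).length ≤ N * (N + 2) := by
    refine (length_encodeGraph_le (n := N) ?_).trans (Nat.mul_le_mul_right _ ?_)
    · intro r hr
      simp only [restrict, pick, List.mem_map, List.mem_filter] at hr
      obtain ⟨r', ⟨⟨b, r''⟩, ⟨hr, -⟩, rfl⟩, rfl⟩ := hr
      have := hR r'' (List.of_mem_zip hr).2
      exact (length_pick_le _ _).trans (by dsimp only; omega)
    · rw [restrict, List.length_map]
      exact (length_pick_le _ _).trans (by omega)
  refine (hread.seq (hscan.seq (hlim.seq ((Runs.clear .cnt _).seq (hsearch.seq (htarget.seq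
    (hwrite.seq ((Runs.clear .mask _).seq ((Runs.clear .lim _).seq ((Runs.clear .rows _).seq
      (Runs.move (a := .out) (b := .inp) (by decide) _))))))))))).to ?_ ?_
  · simp [Stacks.get, Stacks.set, Stacks.empty]
  · have h₁ : R.length * (3 * R.length + 11) ≤ N * (3 * N + 11) := by
      gcongr <;> omega
    have h₂ : M.length * (6 * M.length + 13) ≤ N * (6 * N + 13) := by
      rw [hM]
      gcongr <;> omega
    have h₃ := eval_monotone (limitTime C d) (show x + 1 ≤ N + 1 by omega)
    have h₄ := length_truncate_le (M.count true + 1) l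
    have h₅ : M.length ≤ N := by omega
    simp only [kernelizeTime, Polynomial.eval_add, Polynomial.eval_mul, Polynomial.eval_comp,
      Polynomial.eval_pow, Polynomial.eval_X, Polynomial.eval_C, Polynomial.eval_one,
      Polynomial.eval_ofNat]
    simp only [Stacks.get, Stacks.set, List.length_replicate, List.length_map, List.length_append,
      List.length_cons, List.length_reverse]
    dsimp only at h₃
    generalize (limitTime C d).eval (x + 1) = a₁ at *
    generalize (limitTime C d).eval (N + 1) = a₂ at *
    generalize (searchTime c).eval _ = a₃ at *
    generalize C * (N + 1) ^ d = a₄ at *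
    nlinarith

/-- The kernelization program runs in polynomial time, for every encoding of instances as a number
followed by a graph with a vertex set. -/
theorem kernelize_polyTime (useX : Bool) (c C d : ℕ) {α : Type} {enc : α → List (Option Bool)}
    {K : α → α} (num : α → List Bool) (graph : α → List (Bool × List Bool))
    (hgraph : ∀ a, ∀ r ∈ graph a, r.2.length = (graph a).length)
    (henc : ∀ a, enc a = (num a).map some ++ none :: encodeGraph (graph a))
    (hnum : ∀ a, num (K a) = truncate ((keptMask useX c C d (graph a)).count true + 1) (num a))
    (hK : ∀ a, graph (K a) = restrict (keptMask useX c C d (graph a)) (graph a)) :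
    Nonempty (Turing.TM2ComputableInPolyTime enc enc K) := by
  refine tm2ComputableInPolyTime (kernelize useX c C d) .inp .inp (kernelizeTime c C d) fun a => ?_
  obtain ⟨t, ht, he⟩ := runs_kernelize useX c C d (num a) (graph a) (hgraph a)
  rw [← henc, ← hnum, ← hK, ← henc, ← Stacks.update_get, ← Stacks.update_get,
    Stacks.get_empty] at he
  rw [← henc] at ht
  exact ⟨t, ht, he⟩

end RegProg

namespace RegProg

/-! ### Which vertices are kept -/

/-- Each element of `V` belongs to `M`, or else at least `ℓ` elements of `V` do, for sets `V` and
`M` given by their characteristic vectors. -/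
def Saturates (ℓ : ℕ) (V M : List Bool) : Prop :=
  (∀ i : ℕ, V[i]? = some true → M[i]? = some true) ∨
    ∃ S : Finset ℕ, S.card = ℓ ∧ ∀ i ∈ S, V[i]? = some true ∧ M[i]? = some true

theorem Saturates.mono {ℓ : ℕ} {V M M' : List Bool} (h : Saturates ℓ V M)
    (hM : ∀ i : ℕ, M[i]? = some true → M'[i]? = some true) : Saturates ℓ V M' := by
  rcases h with h | ⟨S, hS, h⟩
  · exact Or.inl fun i hi => hM i (h i hi)
  · exact Or.inr ⟨S, hS, fun i hi => ⟨(h i hi).1, hM i (h i hi).2⟩⟩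

theorem Saturates.cons {ℓ : ℕ} {V M : List Bool} (h : Saturates ℓ V M) {a b : Bool}
    (hab : a = true → b = true) : Saturates ℓ (a :: V) (b :: M) := by
  rcases h with h | ⟨S, hS, h⟩
  · refine Or.inl fun i hi => ?_
    cases i with
    | zero => simpa using hab (by simpa using hi)
    | succ i => simpa using h i (by simpa using hi)
  · refine Or.inr ⟨S.map ⟨Nat.succ, Nat.succ_injective⟩, by simpa using hS, fun i hi => ?_⟩
    obtain ⟨j, hj, rfl⟩ := Finset.mem_map.mp hi
    simpa using h j hj

theorem saturates_zero (V M : List Bool) : Saturates 0 V M :=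
  Or.inr ⟨∅, rfl, by simp⟩

theorem Saturates.succ_cons {ℓ : ℕ} {V M : List Bool} (h : Saturates ℓ V M) :
    Saturates (ℓ + 1) (true :: V) (true :: M) := by
  rcases h with h | ⟨S, hS, h⟩
  · exact Saturates.cons (Or.inl h) fun _ => rfl
  · refine Or.inr ⟨Finset.cons 0 (S.map ⟨Nat.succ, Nat.succ_injective⟩) (by simp),
      by simpa using hS, fun i hi => ?_⟩
    rcases Finset.mem_cons.mp hi with rfl | hi
    · simp
    · obtain ⟨j, hj, rfl⟩ := Finset.mem_map.mp hi
      simpa using h j hj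

theorem saturates_markLeaf : ∀ (ℓ : ℕ) (V M : List Bool), M.length = V.length →
    Saturates ℓ V (markLeaf ℓ V M)
  | _, [], _, _ => Or.inl (by simp)
  | _, _ :: _, [], h => by simp at h
  | ℓ, false :: V, m :: M, h => by
    simp only [List.length_cons, Nat.add_right_cancel_iff] at h
    exact (saturates_markLeaf ℓ V M h).cons (by simp)
  | 0, true :: V, m :: M, h => saturates_zero _ _
  | ℓ + 1, true :: V, m :: M, h => by
    simp only [List.length_cons, Nat.add_right_cancel_iff] at h
    exact (saturates_markLeaf ℓ V M h).succ_cons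

theorem le_markLeaf : ∀ (ℓ : ℕ) (V M : List Bool), M.length = V.length →
    ∀ i : ℕ, M[i]? = some true → (markLeaf ℓ V M)[i]? = some true
  | _, [], M, h, i, hi => by
    simp only [List.length_nil, List.length_eq_zero_iff] at h
    simp [h] at hi
  | _, _ :: _, [], h, _, _ => by simp at h
  | ℓ, false :: V, m :: M, h, i, hi => by
    simp only [List.length_cons, Nat.add_right_cancel_iff] at h
    cases i with
    | zero => simpa [markLeaf] using hi
    | succ i => simpa [markLeaf] using le_markLeaf ℓ V M h i (by simpa using hi)
  | 0, true :: V, m :: M, h, i, hi => by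
    simp only [List.length_cons, Nat.add_right_cancel_iff] at h
    cases i with
    | zero => simpa [markLeaf] using hi
    | succ i => simpa [markLeaf] using le_markLeaf 0 V M h i (by simpa using hi)
  | ℓ + 1, true :: V, m :: M, h, i, hi => by
    simp only [List.length_cons, Nat.add_right_cancel_iff] at h
    cases i with
    | zero => simp [markLeaf]
    | succ i => simpa [markLeaf] using le_markLeaf ℓ V M h i (by simpa using hi)

theorem count_markLeaf_le : ∀ (ℓ : ℕ) (V M : List Bool),
    (markLeaf ℓ V M).count true ≤ M.count true + ℓ
  | _, [], _ => by simp [markLeaf]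
  | _, _ :: _, [] => by simp [markLeaf]
  | ℓ, false :: V, m :: M => by
    have := count_markLeaf_le ℓ V M
    simp only [markLeaf, List.count_cons]
    omega
  | 0, true :: V, m :: M => by
    have := count_markLeaf_le 0 V M
    simp only [markLeaf, List.count_cons]
    omega
  | ℓ + 1, true :: V, m :: M => by
    have := count_markLeaf_le ℓ V M
    simp only [markLeaf, List.count_cons, beq_self_eq_true, if_true]
    omega

theorem count_mark_le (rows : List (List Bool)) (ℓ : ℕ) : ∀ (j : ℕ) (V M : List Bool),
    (mark rows ℓ j V M).count true ≤ M.count true + (2 * rows.length + 1) ^ j * ℓ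
  | 0, V, M => by simpa [mark] using count_markLeaf_le ℓ V M
  | j + 1, V, M => by
    have h₀ := count_mark_le rows ℓ j V M
    rw [mark]
    generalize mark rows ℓ j V M = M₀ at h₀
    have H : ∀ (L : List (List Bool)) (M₀ : List Bool), (L.foldl (fun M r =>
        mark rows ℓ j (refine false V r) (mark rows ℓ j (refine true V r) M)) M₀).count true ≤
        M₀.count true + L.length * (2 * ((2 * rows.length + 1) ^ j * ℓ)) := by
      intro L
      induction L with
      | nil => simp
      | cons r L ih =>
        intro M₀
        have h₁ := count_mark_le rows ℓ j (refine true V r) M₀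
        have h₂ := count_mark_le rows ℓ j (refine false V r) (mark rows ℓ j (refine true V r) M₀)
        refine (ih _).trans ?_
        rw [List.length_cons, Nat.add_mul]
        dsimp only
        omega
    refine (H rows M₀).trans ?_
    have e : (2 * rows.length + 1) ^ (j + 1) * ℓ = (2 * rows.length + 1) ^ j * ℓ +
        rows.length * (2 * ((2 * rows.length + 1) ^ j * ℓ)) := by ring
    omega

theorem le_mark {rows : List (List Bool)} {ℓ n : ℕ} (hrows : ∀ r ∈ rows, r.length = n) :
    ∀ (j : ℕ) (V M : List Bool), V.length = n → M.length = n →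
      ∀ i : ℕ, M[i]? = some true → (mark rows ℓ j V M)[i]? = some true
  | 0, V, M, hV, hM => le_markLeaf ℓ V M (hM.trans hV.symm)
  | j + 1, V, M, hV, hM => by
    intro i hi
    refine (List.foldlRecOn (motive := fun M : List Bool => M.length = n ∧ M[i]? = some true) rows
      _ ⟨length_mark hrows j V M hV hM, le_mark hrows j V M hV hM i hi⟩ fun M' hM' r hr => ?_).2
    have hr' := (length_refine (b := true) ((hrows r hr).trans hV.symm)).trans hV
    have hr'' := (length_refine (b := false) ((hrows r hr).trans hV.symm)).trans hV
    have h := length_mark (ℓ := ℓ) hrows j _ _ hr' hM'.1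
    exact ⟨length_mark hrows j _ _ hr'' h,
      le_mark hrows j _ _ hr'' h i (le_mark hrows j _ _ hr' hM'.1 i hM'.2)⟩

/-- Every set that arises by prescribing the entries in at most `j` rows is saturated. -/
theorem saturates_mark {rows : List (List Bool)} {ℓ n : ℕ} (hrows : ∀ r ∈ rows, r.length = n) :
    ∀ (j : ℕ) (V M : List Bool), V.length = n → M.length = n →
      ∀ L : List (Bool × List Bool), L.length ≤ j → (∀ r ∈ L, r.2 ∈ rows) →
        Saturates ℓ (L.foldl (fun V r => refine r.1 V r.2) V) (mark rows ℓ j V M)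
  | 0, V, M, hV, hM, L, hL, _ => by
    obtain rfl : L = [] := List.eq_nil_of_length_eq_zero (Nat.le_zero.mp hL)
    exact saturates_markLeaf ℓ V M (hM.trans hV.symm)
  | j + 1, V, M, hV, hM, L, hL, hL' => by
    have hlen : ∀ (b : Bool) (r : List Bool), r ∈ rows → (refine b V r).length = n :=
      fun b r hr => (length_refine ((hrows r hr).trans hV.symm)).trans hV
    -- what is saturated at some point stays so, since the loop over the rows only adds elements
    have hfold : ∀ (T : List (List Bool)) (M₀ : List Bool), (∀ r ∈ T, r ∈ rows) → M₀.length = n →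
        (∀ i : ℕ, M₀[i]? = some true → (T.foldl (fun M r =>
          mark rows ℓ j (refine false V r) (mark rows ℓ j (refine true V r) M)) M₀)[i]? =
            some true) ∧ (T.foldl (fun M r =>
          mark rows ℓ j (refine false V r) (mark rows ℓ j (refine true V r) M)) M₀).length = n := by
      intro T
      induction T with
      | nil => exact fun M₀ _ h => ⟨fun i hi => hi, h⟩
      | cons r T ih =>
        intro M₀ hT h
        have hr := hT r List.mem_cons_self
        have h₁ := length_mark (ℓ := ℓ) hrows j _ _ (hlen true r hr) h
        have h₂ := ih (mark rows ℓ j (refine false V r) (mark rows ℓ j (refine true V r) M₀))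
          (fun r' hr' => hT r' (List.mem_cons_of_mem _ hr'))
          (length_mark hrows j _ _ (hlen false r hr) h₁)
        exact ⟨fun i hi => h₂.1 i (le_mark hrows j _ _ (hlen false r hr) h₁ i
          (le_mark hrows j _ _ (hlen true r hr) h i hi)), h₂.2⟩
    rw [mark]
    have h₀ := length_mark (ℓ := ℓ) hrows j V M hV hM
    cases L with
    | nil =>
      exact (saturates_mark hrows j V M hV hM [] (Nat.zero_le _) (by simp)).mono
        (hfold rows _ (fun _ h => h) h₀).1
    | cons a L =>
      obtain ⟨b, r⟩ := a
      have hr : r ∈ rows := hL' (b, r) List.mem_cons_self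
      have hLj : L.length ≤ j := by simpa using hL
      have hLr : ∀ r ∈ L, r.2 ∈ rows := fun r' hr' => hL' r' (List.mem_cons_of_mem _ hr')
      obtain ⟨T₁, T₂, hT⟩ := List.append_of_mem hr
      have hT₁ := hfold T₁ _ (fun r' hr' => by rw [hT]; simp [hr']) h₀
      have h₁ := length_mark (ℓ := ℓ) hrows j _ _ (hlen true r hr) hT₁.2
      have h₂ := length_mark (ℓ := ℓ) hrows j _ _ (hlen false r hr) h₁
      have hT₂ := hfold T₂ _ (fun r' hr' => by rw [hT]; simp [hr']) h₂
      have e := congrArg (fun T => T.foldl (fun M r =>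
        mark rows ℓ j (refine false V r) (mark rows ℓ j (refine true V r) M))
          (mark rows ℓ j V M)) hT
      simp only [List.foldl_append, List.foldl_cons] at e
      rw [e]
      refine Saturates.mono ?_ hT₂.1
      cases b with
      | true =>
        exact (saturates_mark hrows j _ _ (hlen true r hr) hT₁.2 L hLj hLr).mono
          (le_mark hrows j _ _ (hlen false r hr) h₁)
      | false => exact saturates_mark hrows j _ _ (hlen false r hr) h₁ L hLj hLr

theorem getElem?_refine {b : Bool} {V r : List Bool} {i : ℕ} :
    (refine b V r)[i]? = some true ↔ V[i]? = some true ∧ r[i]? = some b := by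
  rw [refine, List.getElem?_zipWith]
  cases V[i]? <;> cases r[i]? <;> simp

theorem getElem?_foldl_refine {i : ℕ} : ∀ {L : List (Bool × List Bool)} {V : List Bool},
    (L.foldl (fun V r => refine r.1 V r.2) V)[i]? = some true ↔
      V[i]? = some true ∧ ∀ r ∈ L, r.2[i]? = some r.1
  | [], V => by simp
  | r :: L, V => by
    rw [List.foldl_cons, getElem?_foldl_refine, getElem?_refine]
    simp [and_assoc]

theorem pick_map_finRange {α : Type} {n : ℕ} {M : List Bool} (hM : M.length = n) (f : Fin n → α) :
    pick M ((List.finRange n).map f) =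
      ((List.finRange n).filter fun i : Fin n => M.getD i false).map f := by
  have e : M = (List.finRange n).map fun i : Fin n => M.getD i false := by
    refine List.ext_getElem (by simp [hM]) fun i h _ => ?_
    simp [h]
  conv_lhs => rw [e]
  rw [pick, List.zip_map', List.filter_map, List.map_map]
  rfl

/-! ### Binary numbers -/

open Computability

theorem two_pow_length_encodeNat_le {k : ℕ} (hk : 1 ≤ k) : 2 ^ (encodeNat k).length ≤ 2 * k := by
  have h : ∀ p : PosNum, 2 ^ (encodePosNum p).length ≤ 2 * (p : ℕ) := by
    intro p
    induction p with
    | one => simp [encodePosNum]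
    | bit0 p ih =>
      simp only [encodePosNum, List.length_cons, pow_succ, PosNum.cast_bit0]
      omega
    | bit1 p ih =>
      simp only [encodePosNum, List.length_cons, pow_succ, PosNum.cast_bit1]
      omega
  unfold encodeNat
  have hk' : (((k : Num) : ℕ)) = k := Num.to_of_nat k
  cases hn : (k : Num) with
  | zero =>
    rw [hn] at hk'
    simp at hk'
    omega
  | pos p =>
    rw [hn] at hk'
    rw [← hk']
    exact h p

theorem encodeNat_two_pow_sub_one (m : ℕ) :
    encodeNat (2 ^ (m + 1) - 1) = List.replicate (m + 1) true := by
  have h : ∃ p : PosNum, (p : ℕ) = 2 ^ (m + 1) - 1 ∧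
      encodePosNum p = List.replicate (m + 1) true := by
    induction m with
    | zero => exact ⟨.one, rfl, rfl⟩
    | succ m ih =>
      obtain ⟨p, hp, he⟩ := ih
      refine ⟨.bit1 p, ?_, ?_⟩
      · rw [PosNum.cast_bit1, hp]
        have : 1 ≤ 2 ^ (m + 1) := Nat.one_le_two_pow
        rw [pow_succ 2 (m + 1)]
        omega
      · rw [encodePosNum, he, ← List.replicate_succ]
  obtain ⟨p, hp, he⟩ := h
  rw [← hp, ← he, encodeNat]
  have : ((p : ℕ) : Num) = Num.pos p := Num.of_to_nat (Num.pos p)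
  rw [this, encodeNum]

/-- The target value whose digits are those of `k`, truncated to `m + 1` digits `1` if there are
more than `m + 1` of them. -/
def truncateTarget (m k : ℕ) : ℕ :=
  if (encodeNat k).length ≤ m + 1 then k else 2 ^ (m + 1) - 1

theorem encodeNat_truncateTarget (m k : ℕ) :
    encodeNat (truncateTarget m k) = truncate (m + 1) (encodeNat k) := by
  unfold truncateTarget truncate
  split_ifs
  · rfl
  · exact encodeNat_two_pow_sub_one m

/-- Truncation does not affect the comparison with numbers up to `m`. -/
theorem truncateTarget_le_iff {m k j : ℕ} (hk : 1 ≤ k) (hj : j ≤ m) :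
    truncateTarget m k ≤ j ↔ k ≤ j := by
  unfold truncateTarget
  split_ifs with h
  · rfl
  · have h₁ := two_pow_length_encodeNat_le hk
    have h₂ : 2 ^ (m + 2) ≤ 2 ^ (encodeNat k).length := Nat.pow_le_pow_right (by simp) (by omega)
    have h₃ : m + 1 < 2 ^ (m + 1) := Nat.lt_two_pow_self
    rw [pow_succ 2 (m + 1)] at h₂
    omega

theorem one_le_truncateTarget {m k : ℕ} (hk : 1 ≤ k) : 1 ≤ truncateTarget m k := by
  by_contra h
  have := (truncateTarget_le_iff (m := m) (j := 0) hk (Nat.zero_le _)).mp (by omega)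
  omega

end RegProg

/-! ### Exchanging vertices in a solution -/

theorem GraphProperty.holds_induce_range_iff (Φ : GraphProperty) {V W : Type} [Finite V] [Finite W]
    (G : SimpleGraph V) (f : W ↪ V) :
    Φ.Holds (G.induce (Set.range f)) ↔ Φ.Holds (G.comap f) :=
  ⟨Φ.iso_closed _ _ ⟨(SimpleGraph.Embedding.comap f G).isoInduceRange.symm⟩,
    Φ.iso_closed _ _ ⟨(SimpleGraph.Embedding.comap f G).isoInduceRange⟩⟩

namespace GraphProperty.CharacterizedByAdjacencies

variable {Φ : GraphProperty} {c : ℕ}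

/-- In an induced subgraph with the property, a vertex `v` can be exchanged for any vertex `u` that
has the same neighbours in a certain set of at most `c` vertices. -/
theorem exists_exchange (h : Φ.CharacterizedByAdjacencies c) {V : Type} [Finite V] [DecidableEq V]
    {G : SimpleGraph V} {P : Finset V} (hP : Φ.Holds (G.induce (P : Set V))) {v : V} (hv : v ∈ P) :
    ∃ D : Finset V, D ⊆ P ∧ D.card ≤ c ∧ ∀ u ∉ P, (∀ d ∈ D, G.Adj u d ↔ G.Adj v d) →
      Φ.Holds (G.induce ((insert u (P.erase v) : Finset V) : Set V)) := by
  obtain ⟨D, hvD, hD, hG⟩ := h _ hP ⟨v, hv⟩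
  refine ⟨D.map (Function.Embedding.subtype _), ?_, by simpa using hD, fun u hu hadj => ?_⟩
  · intro d hd
    obtain ⟨d, -, rfl⟩ := Finset.mem_map.mp hd
    exact d.2
  let f : (P : Set V) ↪ V := ⟨fun a => if a.1 = v then u else a.1, by
    intro a b hab
    have ha : a.1 ≠ u := fun h => hu (h ▸ a.2)
    have hb : b.1 ≠ u := fun h => hu (h ▸ b.2)
    dsimp only at hab
    split_ifs at hab with h₁ h₂ h₂
    · exact Subtype.ext (h₁.trans h₂.symm)
    · exact absurd hab.symm hb
    · exact absurd hab ha
    · exact Subtype.ext hab⟩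
  have hf : Set.range f = ((insert u (P.erase v) : Finset V) : Set V) := by
    ext w
    simp only [Set.mem_range, Finset.coe_insert, Finset.coe_erase, Set.mem_insert_iff,
      Set.mem_sdiff, Finset.mem_coe, Set.mem_singleton_iff]
    constructor
    · rintro ⟨a, rfl⟩
      by_cases ha : a.1 = v
      · exact Or.inl (if_pos ha)
      · refine Or.inr ?_
        rw [show f a = a.1 from if_neg ha]
        exact ⟨a.2, ha⟩
    · rintro (rfl | ⟨hw, hwv⟩)
      · exact ⟨⟨v, hv⟩, if_pos rfl⟩
      · exact ⟨⟨w, hw⟩, if_neg hwv⟩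
  rw [← hf, Φ.holds_induce_range_iff]
  refine hG _ (fun a b ha hb => ?_) fun d hd => ?_
  · have ha' : f a = a.1 := if_neg fun h => ha (Subtype.ext h)
    have hb' : f b = b.1 := if_neg fun h => hb (Subtype.ext h)
    rw [SimpleGraph.comap_adj, ha', hb', SimpleGraph.induce_adj]
  · have hd' : f d = d.1 := if_neg fun h => hvD (by rwa [show d = ⟨v, hv⟩ from Subtype.ext h] at hd)
    have hv' : f ⟨v, hv⟩ = u := if_pos rfl
    rw [SimpleGraph.comap_adj, hd', hv', SimpleGraph.induce_adj]
    exact hadj d (Finset.mem_map_of_mem _ hd)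

/-- A property characterized by no adjacencies depends on the number of vertices only; in
particular, it is inherited by edgeless graphs. -/
theorem holds_bot (h : Φ.CharacterizedByAdjacencies 0) {V : Type} [Finite V] {G : SimpleGraph V}
    (hG : Φ.Holds G) : Φ.Holds (⊥ : SimpleGraph V) := by
  classical
  have := Fintype.ofFinite V
  -- isolate the vertices one by one
  suffices H : ∀ S : Finset V, ∃ G' : SimpleGraph V, Φ.Holds G' ∧ ∀ v ∈ S, ∀ w, ¬ G'.Adj v w by
    obtain ⟨G', hG', hS⟩ := H Finset.univ
    have e : G' = ⊥ := by
      ext v w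
      simpa using hS v (Finset.mem_univ v) w
    exact e ▸ hG'
  intro S
  induction S using Finset.induction_on with
  | empty => exact ⟨G, hG, by simp⟩
  | insert v S _ ih =>
    obtain ⟨G', hG', hS⟩ := ih
    obtain ⟨D, -, hD, hrep⟩ := h G' hG' v
    obtain rfl : D = ∅ := Finset.card_eq_zero.mp (Nat.le_zero.mp hD)
    let G'' : SimpleGraph V :=
      { Adj := fun a b => G'.Adj a b ∧ a ≠ v ∧ b ≠ v
        symm := ⟨fun a b hab => ⟨hab.1.symm, hab.2.2, hab.2.1⟩⟩
        loopless := ⟨fun a ha => G'.loopless.irrefl a ha.1⟩ }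
    refine ⟨G'', hrep G'' (fun a b ha hb => ?_) (by simp), fun w hw x hwx => ?_⟩
    · exact ⟨fun h => h.1, fun h => ⟨h, ha, hb⟩⟩
    · rcases Finset.mem_insert.mp hw with rfl | hw
      · exact hwx.2.1 rfl
      · exact hS w hw x hwx.1

end GraphProperty.CharacterizedByAdjacencies

/-- If a vertex outside `M` can always be exchanged for one in `M`, then there is a solution of the
same size inside `M`. -/
theorem exists_subset_of_exchange {V : Type} [DecidableEq V] (Q : Finset V → Prop) (M : Finset V)
    (h : ∀ P, Q P → ∀ v ∈ P, v ∉ M → ∃ u ∈ M, u ∉ P ∧ Q (insert u (P.erase v)))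
    (P : Finset V) (hP : Q P) : ∃ P', P' ⊆ M ∧ P'.card = P.card ∧ Q P' := by
  induction hn : (P \ M).card generalizing P with
  | zero =>
    exact ⟨P, Finset.sdiff_eq_empty_iff_subset.mp (Finset.card_eq_zero.mp hn), rfl, hP⟩
  | succ n ih =>
    obtain ⟨v, hv⟩ : (P \ M).Nonempty := Finset.card_pos.mp (by omega)
    have hv' := Finset.mem_sdiff.mp hv
    obtain ⟨u, hu, huP, hQ⟩ := h P hP v hv'.1 hv'.2
    obtain ⟨P', h₁, h₂, h₃⟩ := ih (insert u (P.erase v)) hQ (by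
      have e : insert u (P.erase v) \ M = (P \ M).erase v := by
        ext w
        simp only [Finset.mem_sdiff, Finset.mem_insert, Finset.mem_erase]
        constructor
        · rintro ⟨rfl | hw, hwM⟩
          · exact absurd hu hwM
          · exact ⟨hw.1, hw.2, hwM⟩
        · rintro ⟨hw, hwP, hwM⟩
          exact ⟨Or.inr ⟨hw, hwP⟩, hwM⟩
      rw [e, Finset.card_erase_of_mem hv, hn]
      rfl)
    refine ⟨P', h₁, h₂.trans ?_, h₃⟩
    rw [Finset.card_insert_of_notMem fun h => huP (Finset.mem_of_mem_erase h),
      Finset.card_erase_add_one hv'.1]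

namespace VCInstance

/-! ### The reduced instance -/

/-- The vertices of `I` at which the mask `M` is true, in increasing order. -/
def kept (I : VCInstance) (M : List Bool) : List (Fin I.n) :=
  (List.finRange I.n).filter fun i : Fin I.n => M.getD i false

theorem mem_kept {I : VCInstance} {M : List Bool} {v : Fin I.n} :
    v ∈ I.kept M ↔ M[(v : ℕ)]? = some true := by
  rw [kept, List.mem_filter, List.getD_eq_getElem?_getD]
  cases M[(v : ℕ)]? <;> simp [List.mem_finRange]

theorem nodup_kept (I : VCInstance) (M : List Bool) : (I.kept M).Nodup :=
  (List.nodup_finRange _).filter _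

theorem length_kept {I : VCInstance} {M : List Bool} (hM : M.length = I.n) :
    (I.kept M).length = M.count true := by
  have e : M = (List.finRange I.n).map fun i : Fin I.n => M.getD i false := by
    refine List.ext_getElem (by simp [hM]) fun i h _ => ?_
    simp [h]
  conv_rhs => rw [e]
  rw [List.count_eq_countP, List.countP_map, List.countP_eq_length_filter, kept]
  simp [Function.comp_def]

/-- The embedding of the vertices of the reduced instance. -/
def keptEmbedding (I : VCInstance) (M : List Bool) : Fin (I.kept M).length ↪ Fin I.n :=
  ⟨(I.kept M).get, List.nodup_iff_injective_get.mp (I.nodup_kept M)⟩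

open Classical in
/-- The restriction of an instance to the vertices at which the mask `M` is true. The target value
is truncated to keep its encoding short. -/
noncomputable def restrict (I : VCInstance) (M : List Bool) : VCInstance where
  n := (I.kept M).length
  G := I.G.comap (I.keptEmbedding M)
  X := {i | I.keptEmbedding M i ∈ I.X}
  cover := fun i j hij => by simpa using I.cover hij
  k := RegProg.truncateTarget (I.kept M).length I.k
  one_le_k := RegProg.one_le_truncateTarget I.one_le_k

open Classical in
/-- The membership bits and the adjacency matrix of an instance. -/
noncomputable def table (I : VCInstance) : List (Bool × List Bool) :=
  (List.finRange I.n).map fun i =>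
    (decide (i ∈ I.X), (List.finRange I.n).map fun j => decide (I.G.Adj i j))

theorem encode_eq (I : VCInstance) :
    I.encode = (Computability.encodeNat I.k).map some ++ none :: RegProg.encodeGraph I.table := by
  rw [encode, RegProg.encodeGraph, table, List.flatMap_map, List.append_assoc]
  rfl

theorem length_table (I : VCInstance) : I.table.length = I.n := by
  simp [table]

theorem length_of_mem_table {I : VCInstance} {r : Bool × List Bool} (hr : r ∈ I.table) :
    r.2.length = I.table.length := by
  rw [length_table]
  simp only [table, List.mem_map] at hr
  obtain ⟨i, -, rfl⟩ := hr
  simp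

theorem mem_X_restrict {I : VCInstance} {M : List Bool} (i : Fin (I.kept M).length) :
    i ∈ (I.restrict M).X ↔ I.keptEmbedding M i ∈ I.X :=
  Finset.mem_filter_univ i

theorem table_restrict {I : VCInstance} {M : List Bool} (hM : M.length = I.n) :
    (I.restrict M).table = RegProg.restrict M I.table := by
  have hget : ∀ {α : Type} (g : Fin I.n → α),
      (List.finRange (I.kept M).length).map (fun i => g (I.keptEmbedding M i)) =
        (I.kept M).map g := by
    intro α g
    conv_rhs => rw [← List.map_get_finRange (I.kept M), List.map_map]
    rfl
  classical
  rw [RegProg.restrict, table, table, RegProg.pick_map_finRange hM, List.map_map]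
  refine Eq.trans ?_ ((hget _).trans rfl)
  refine List.map_congr_left fun i _ => ?_
  refine Prod.ext (decide_eq_decide.mpr (mem_X_restrict i)) ?_
  simp only [Function.comp_apply]
  rw [RegProg.pick_map_finRange hM]
  exact hget (fun j => decide (I.G.Adj (I.keptEmbedding M i) j))

theorem yes_restrict_iff (Φ : GraphProperty) {I : VCInstance} {M : List Bool} :
    (largestInducedVC Φ).Yes (I.restrict M) ↔
      ∃ P : Finset (Fin I.n), (∀ v ∈ P, v ∈ I.kept M) ∧ I.k ≤ P.card ∧
        Φ.Holds (I.G.induce (P : Set (Fin I.n))) := by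
  have key : ∀ P : Finset (Fin (I.kept M).length),
      Φ.Holds (I.G.induce ((P.map (I.keptEmbedding M) : Finset (Fin I.n)) : Set (Fin I.n))) ↔
        Φ.Holds ((I.restrict M).G.induce (P : Set (Fin (I.kept M).length))) := by
    intro P
    let f : (P : Set (Fin (I.kept M).length)) ↪ Fin I.n :=
      (Function.Embedding.subtype _).trans (I.keptEmbedding M)
    have hf : Set.range f = ((P.map (I.keptEmbedding M) : Finset (Fin I.n)) : Set (Fin I.n)) := by
      ext v
      simp [f]
    rw [← hf]
    exact Φ.holds_induce_range_iff I.G f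
  have hcard : ∀ P : Finset (Fin (I.kept M).length), P.card ≤ (I.kept M).length := fun P => by
    simpa using Finset.card_le_univ P
  refine Iff.trans (b := ∃ P : Finset (Fin (I.kept M).length),
    RegProg.truncateTarget (I.kept M).length I.k ≤ P.card ∧
      Φ.Holds ((I.restrict M).G.induce (P : Set (Fin (I.kept M).length)))) Iff.rfl ?_
  constructor
  · rintro ⟨P, hk, hP⟩
    refine ⟨P.map (I.keptEmbedding M), fun v hv => ?_, ?_, (key P).mpr hP⟩
    · obtain ⟨i, -, rfl⟩ := Finset.mem_map.mp hv
      exact List.get_mem _ _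
    · rw [Finset.card_map]
      exact (RegProg.truncateTarget_le_iff I.one_le_k (hcard P)).mp hk
  · rintro ⟨P, hPM, hk, hP⟩
    have hpre : (P.preimage (I.keptEmbedding M) (I.keptEmbedding M).injective.injOn).map
        (I.keptEmbedding M) = P := by
      ext v
      simp only [Finset.mem_map, Finset.mem_preimage]
      constructor
      · rintro ⟨i, hi, rfl⟩
        exact hi
      · intro hv
        obtain ⟨i, hi⟩ := List.mem_iff_get.mp (hPM v hv)
        exact ⟨i, by rwa [show I.keptEmbedding M i = v from hi], hi⟩
    rw [← hpre] at hP hk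
    rw [Finset.card_map] at hk
    exact ⟨_, (RegProg.truncateTarget_le_iff I.one_le_k (hcard _)).mpr hk, (key _).mp hP⟩

theorem length_encode_restrict_le (I : VCInstance) (M : List Bool) :
    (I.restrict M).encode.length ≤
      (I.kept M).length + 2 + (I.kept M).length * ((I.kept M).length + 2) := by
  rw [encode_eq, List.length_append, List.length_map, List.length_cons]
  have h₁ : (Computability.encodeNat (I.restrict M).k).length ≤ (I.kept M).length + 1 := by
    change (Computability.encodeNat (RegProg.truncateTarget _ _)).length ≤ _
    rw [RegProg.encodeNat_truncateTarget, RegProg.truncate]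
    split_ifs with h
    · exact h
    · simp
  have h₂ := RegProg.length_encodeGraph_le (R := (I.restrict M).table) (n := (I.kept M).length)
    fun r hr => ((length_of_mem_table hr).trans (length_table _)).le
  rw [length_table] at h₂
  change _ ≤ (I.kept M).length * _ at h₂
  omega

/-! ### The kernel -/

open Classical in
theorem length_coverRows_table (I : VCInstance) :
    (RegProg.coverRows I.table).length = I.X.card := by
  rw [RegProg.coverRows, List.length_map, table, List.filter_map, List.length_map]
  have h : ((List.finRange I.n).filter fun i => decide (i ∈ I.X)).toFinset = I.X := by
    ext i
    simp
  rw [← List.toFinset_card_of_nodup ((List.nodup_finRange _).filter _)]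
  exact congrArg Finset.card h

/-- The mask of the vertices of an instance that the kernelization keeps. -/
noncomputable def keptMask (useX : Bool) (c C d : ℕ) (I : VCInstance) : List Bool :=
  RegProg.keptMask useX c C d I.table

theorem length_keptMask (useX : Bool) (c C d : ℕ) (I : VCInstance) :
    (I.keptMask useX c C d).length = I.n :=
  (RegProg.length_keptMask useX c C d fun _ => length_of_mem_table).trans I.length_table

theorem length_kept_keptMask_le (useX : Bool) (c C d : ℕ) (I : VCInstance) :
    (I.kept (I.keptMask useX c C d)).length ≤ (if useX then I.X.card else 0) +
      (2 * I.X.card + 1) ^ c * (C * (I.X.card + 1) ^ d) := by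
  rw [length_kept (I.length_keptMask ..), keptMask, RegProg.keptMask]
  refine (RegProg.count_mark_le ..).trans ?_
  rw [length_coverRows_table]
  refine Nat.add_le_add_right ?_ _
  rw [List.count_eq_countP, List.countP_map, List.countP_eq_length_filter]
  cases useX with
  | false => simp [Function.comp_def]
  | true =>
    rw [if_pos rfl, ← length_coverRows_table, RegProg.coverRows, List.length_map]
    simp [Function.comp_def]

/-- If a vertex `v` is not kept, then for each set `Y` of at most `c` vertices of the cover, there
are many kept vertices with the same neighbours in `Y` as `v`. -/
theorem exists_kept_of_not_mem {useX : Bool} {c C d : ℕ} {I : VCInstance} {v : Fin I.n}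
    (hv : v ∉ I.kept (I.keptMask useX c C d)) {Y : Finset (Fin I.n)} (hY : Y ⊆ I.X)
    (hYc : Y.card ≤ c) :
    (useX = true → v ∉ I.X) ∧ ∃ S : Finset (Fin I.n), S.card = C * (I.X.card + 1) ^ d ∧
      ∀ u ∈ S, u ∈ I.kept (I.keptMask useX c C d) ∧ (useX = true → u ∉ I.X) ∧
        ∀ y ∈ Y, I.G.Adj y u ↔ I.G.Adj y v := by
  classical
  have hrows : ∀ r ∈ RegProg.coverRows I.table, r.length = I.table.length := fun r hr => by
    simp only [RegProg.coverRows, List.mem_map, List.mem_filter] at hr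
    obtain ⟨r, ⟨hr, -⟩, rfl⟩ := hr
    exact length_of_mem_table hr
  have hX : ∀ u : Fin I.n, (I.table.map (·.1 && useX))[(u : ℕ)]? =
      some (decide (u ∈ I.X) && useX) := by
    intro u
    simp [table]
  have hcand : ∀ u : Fin I.n, ((I.table.map (·.1 && useX)).map not)[(u : ℕ)]? = some true ↔
      (useX = true → u ∉ I.X) := by
    intro u
    rw [List.getElem?_map, hX]
    cases useX <;> simp
  have hvX : useX = true → v ∉ I.X := by
    intro h₁ h₂
    refine hv (mem_kept.mpr (RegProg.le_mark hrows c _ _ (by simp) (by simp) v ?_))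
    rw [hX]
    simp [h₁, h₂]
  refine ⟨hvX, ?_⟩
  have hsat := RegProg.saturates_mark (ℓ := C * (I.X.card + 1) ^ d) hrows c
    ((I.table.map (·.1 && useX)).map not) (I.table.map (·.1 && useX)) (by simp) (by simp)
    (Y.toList.map fun y => (decide (I.G.Adj y v),
      (List.finRange I.n).map fun j => decide (I.G.Adj y j))) (by simpa using hYc) (by
      intro r hr
      obtain ⟨y, hy, rfl⟩ := List.mem_map.mp hr
      refine List.mem_map.mpr ⟨(decide (y ∈ I.X), (List.finRange I.n).map fun j =>
        decide (I.G.Adj y j)), List.mem_filter.mpr ⟨List.mem_map.mpr ⟨y, by simp, rfl⟩, ?_⟩, rfl⟩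
      simpa using hY (Finset.mem_toList.mp hy))
  have hmem : ∀ u : Fin I.n, ((Y.toList.map fun y => (decide (I.G.Adj y v),
      (List.finRange I.n).map fun j => decide (I.G.Adj y j))).foldl
        (fun V r => RegProg.refine r.1 V r.2) ((I.table.map (·.1 && useX)).map not))[(u : ℕ)]? =
          some true ↔ (useX = true → u ∉ I.X) ∧ ∀ y ∈ Y, I.G.Adj y u ↔ I.G.Adj y v := by
    intro u
    rw [RegProg.getElem?_foldl_refine, hcand]
    simp
  rw [← length_coverRows_table] at hsat ⊢
  rcases hsat with h | ⟨S, hS, h⟩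
  · exact absurd (mem_kept.mpr (h v ((hmem v).mpr ⟨hvX, fun _ _ => Iff.rfl⟩))) hv
  · have hSn : ∀ i ∈ S, i < I.n := fun i hi => by
      have := (List.getElem?_eq_some_iff.mp (h i hi).2).1
      have hl := I.length_keptMask useX c C d
      rw [keptMask, RegProg.keptMask] at hl
      omega
    refine ⟨S.attachFin hSn, by simpa using hS, fun u hu => ?_⟩
    have hu' := h u (Finset.mem_attachFin hSn |>.mp hu)
    exact ⟨mem_kept.mpr hu'.2, (hmem u).mp hu'.1⟩

/-- The reduced instance is equivalent, provided that all solutions are small enough. If the cover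
is not kept as a whole, then the property has to be characterized by no adjacencies, or else there
must be no nonempty solutions. -/
theorem yes_restrict_keptMask_iff {Φ : GraphProperty} {c : ℕ}
    (hadj : Φ.CharacterizedByAdjacencies c) {useX : Bool} {c' C d : ℕ}
    (hparam : useX = true ∧ c' = c ∨ c = 0 ∨ C = 0) {I : VCInstance}
    (hsmall : ∀ P : Finset (Fin I.n), Φ.Holds (I.G.induce (P : Set (Fin I.n))) →
      P.card ≤ C * (I.X.card + 1) ^ d) :
    (largestInducedVC Φ).Yes (I.restrict (I.keptMask useX c' C d)) ↔
      (largestInducedVC Φ).Yes I := by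
  classical
  rw [yes_restrict_iff]
  constructor
  · rintro ⟨P, -, hk, hP⟩
    exact ⟨P, hk, hP⟩
  rintro ⟨P, hk, hP⟩
  suffices hexch : ∀ P : Finset (Fin I.n), Φ.Holds (I.G.induce (P : Set (Fin I.n))) → ∀ v ∈ P,
      v ∉ (I.kept (I.keptMask useX c' C d)).toFinset →
      ∃ u ∈ (I.kept (I.keptMask useX c' C d)).toFinset, u ∉ P ∧
        Φ.Holds (I.G.induce ((insert u (P.erase v) : Finset (Fin I.n)) : Set (Fin I.n))) by
    obtain ⟨P', h₁, h₂, h₃⟩ := exists_subset_of_exchange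
      (fun P : Finset (Fin I.n) => Φ.Holds (I.G.induce (P : Set (Fin I.n)))) _ hexch P hP
    exact ⟨P', fun v hv => List.mem_toFinset.mp (h₁ hv), hk.trans h₂.ge, h₃⟩
  clear hk hP P
  intro P hP v hv hvM
  rw [List.mem_toFinset] at hvM
  obtain ⟨D, hDP, hDc, hex⟩ := hadj.exists_exchange hP hv
  have hcard := hsmall P hP
  have hpos : 0 < P.card := Finset.card_pos.mpr ⟨v, hv⟩
  -- a candidate for the exchange lies outside `P`, since the kept candidates are at least as many
  -- as the elements of `P`, and the element `v` of `P` is not kept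
  have hout : ∀ S : Finset (Fin I.n), S.card = C * (I.X.card + 1) ^ d →
      (∀ u ∈ S, u ∈ I.kept (I.keptMask useX c' C d)) → ∃ u ∈ S, u ∉ P := by
    intro S hS hSM
    by_contra! hSP
    have h : S ⊆ P.erase v := fun u hu =>
      Finset.mem_erase.mpr ⟨fun e => hvM (e ▸ hSM u hu), hSP u hu⟩
    have := Finset.card_le_card h
    rw [Finset.card_erase_of_mem hv] at this
    omega
  rcases hparam with ⟨rfl, rfl⟩ | rfl | rfl
  · obtain ⟨hvX, S, hS, hSM⟩ := exists_kept_of_not_mem hvM (Y := D ∩ I.X)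
      Finset.inter_subset_right ((Finset.card_le_card Finset.inter_subset_left).trans hDc)
    obtain ⟨u, hu, huP⟩ := hout S hS fun u hu => (hSM u hu).1
    obtain ⟨huM, huX, hY⟩ := hSM u hu
    refine ⟨u, List.mem_toFinset.mpr huM, huP, hex u huP fun w hw => ?_⟩
    by_cases hwX : w ∈ I.X
    · rw [I.G.adj_comm u, I.G.adj_comm v]
      exact hY w (Finset.mem_inter.mpr ⟨hw, hwX⟩)
    · -- vertices outside the cover are pairwise non-adjacent
      have hno : ∀ a : Fin I.n, a ∉ I.X → ¬ I.G.Adj a w := fun a ha h =>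
        (I.cover h).elim ha hwX
      exact iff_of_false (hno u (huX rfl)) (hno v (hvX rfl))
  · obtain rfl : D = ∅ := Finset.card_eq_zero.mp (Nat.le_zero.mp hDc)
    obtain ⟨-, S, hS, hSM⟩ := exists_kept_of_not_mem hvM (Y := ∅) (Finset.empty_subset _) (by simp)
    obtain ⟨u, hu, huP⟩ := hout S hS fun u hu => (hSM u hu).1
    exact ⟨u, List.mem_toFinset.mpr (hSM u hu).1, huP, hex u huP (by simp)⟩
  · omega

end VCInstance

/-- The kernelization with given parameters. -/
theorem exists_isKernelization {Φ : GraphProperty} {c : ℕ} (hadj : Φ.CharacterizedByAdjacencies c)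
    (useX : Bool) {c' C d : ℕ} (hparam : useX = true ∧ c' = c ∨ c = 0 ∨ C = 0)
    (hsmall : ∀ (I : VCInstance) (P : Finset (Fin I.n)),
      Φ.Holds (I.G.induce (P : Set (Fin I.n))) → P.card ≤ C * (I.X.card + 1) ^ d) :
    ∃ (K : VCInstance → VCInstance) (size : Polynomial ℕ),
      IsKernelization (largestInducedVC Φ) K (fun x => size.eval x) ∧
      ∀ I : VCInstance, (K I).n ≤ (if useX then I.X.card else 0) +
        (2 * I.X.card + 1) ^ c' * (C * (I.X.card + 1) ^ d) := by
  let F : Polynomial ℕ := Polynomial.X + (2 * Polynomial.X + 1) ^ c' *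
    (Polynomial.C C * (Polynomial.X + 1) ^ d)
  have hn := VCInstance.length_kept_keptMask_le useX c' C d
  have hF : ∀ I : VCInstance,
      (I.kept (I.keptMask useX c' C d)).length ≤ F.eval I.X.card := fun I => by
    refine (hn I).trans ?_
    simp only [F, Polynomial.eval_add, Polynomial.eval_mul, Polynomial.eval_pow, Polynomial.eval_X,
      Polynomial.eval_C, Polynomial.eval_one, Polynomial.eval_ofNat]
    gcongr
    split_ifs <;> simp
  refine ⟨fun I => I.restrict (I.keptMask useX c' C d), F + 2 + F * (F + 2),
    ⟨?_, fun I => ?_, fun I => ?_, fun I => ?_⟩, hn⟩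
  · refine RegProg.kernelize_polyTime useX c' C d (fun I => Computability.encodeNat I.k)
      VCInstance.table (fun I r => VCInstance.length_of_mem_table) VCInstance.encode_eq
      (fun I => ?_) (fun I => VCInstance.table_restrict (I.length_keptMask ..))
    change Computability.encodeNat (RegProg.truncateTarget _ _) = _
    rw [RegProg.encodeNat_truncateTarget, VCInstance.length_kept (I.length_keptMask ..)]
    rfl
  · exact VCInstance.yes_restrict_keptMask_iff hadj hparam (hsmall I)
  · refine (I.length_encode_restrict_le _).trans ?_
    have := hF I
    simp only [Polynomial.eval_add, Polynomial.eval_mul, Polynomial.eval_ofNat]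
    change _ ≤ F.eval I.X.card + 2 + F.eval I.X.card * (F.eval I.X.card + 2)
    gcongr
  · have h₁ : (I.restrict (I.keptMask useX c' C d)).X.card ≤
        (I.kept (I.keptMask useX c' C d)).length :=
      (Finset.card_le_univ (α := Fin (I.kept (I.keptMask useX c' C d)).length) _).trans (by simp)
    refine h₁.trans ((hF I).trans ?_)
    simp only [Polynomial.eval_add, Polynomial.eval_mul, Polynomial.eval_ofNat]
    change _ ≤ F.eval I.X.card + 2 + F.eval I.X.card * (F.eval I.X.card + 2)
    omega

/-! ### Size bounds -/

/-- A polynomial function is bounded by a multiple of a power of `n + 1` of the same order. -/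
theorem exists_le_mul_pow {p : ℕ → ℕ} {q : Polynomial ℝ} (hq : ∀ n : ℕ, (p n : ℝ) = q.eval (n : ℝ))
    (hq₀ : q ≠ 0) : ∃ C d : ℕ, (∀ n, p n ≤ C * (n + 1) ^ d) ∧
      (fun n : ℕ => ((C * (n + 1) ^ d : ℕ) : ℝ)) =O[atTop] (fun n : ℕ => (p n : ℝ)) := by
  obtain ⟨C, hC⟩ := exists_nat_ge (∑ i ∈ Finset.range (q.natDegree + 1), |q.coeff i|)
  refine ⟨C, q.natDegree, fun n => ?_, ?_⟩
  · have h : (p n : ℝ) ≤ C * ((n : ℝ) + 1) ^ q.natDegree := by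
      rw [hq, Polynomial.eval_eq_sum_range]
      calc ∑ i ∈ Finset.range (q.natDegree + 1), q.coeff i * (n : ℝ) ^ i
          ≤ ∑ i ∈ Finset.range (q.natDegree + 1), |q.coeff i| * ((n : ℝ) + 1) ^ q.natDegree := by
            refine Finset.sum_le_sum fun i hi => ?_
            have hi' : i ≤ q.natDegree := Nat.lt_succ_iff.mp (Finset.mem_range.mp hi)
            have h₁ : (n : ℝ) ^ i ≤ ((n : ℝ) + 1) ^ q.natDegree :=
              (pow_le_pow_left₀ (by positivity) (by linarith) i).trans
                (pow_le_pow_right₀ (by linarith [n.cast_nonneg (α := ℝ)]) hi')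
            exact (mul_le_mul_of_nonneg_right (le_abs_self _) (by positivity)).trans
              (mul_le_mul_of_nonneg_left h₁ (abs_nonneg _))
        _ ≤ C * ((n : ℝ) + 1) ^ q.natDegree := by
            rw [← Finset.sum_mul]
            gcongr
    exact_mod_cast h
  · have h := Polynomial.isBigO_atTop_of_degree_le
      (Polynomial.C (C : ℝ) * (Polynomial.X + 1) ^ q.natDegree) q (by
        rw [Polynomial.degree_eq_natDegree hq₀]
        refine Polynomial.natDegree_le_iff_degree_le.mp ?_
        refine (Polynomial.natDegree_C_mul_le _ _).trans (Polynomial.natDegree_pow_le.trans ?_)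
        have : (Polynomial.X + 1 : Polynomial ℝ).natDegree = 1 := by
          simpa using Polynomial.natDegree_X_add_C (1 : ℝ)
        rw [this, mul_one])
    have h' := h.comp_tendsto tendsto_natCast_atTop_atTop
    refine (h'.congr (fun n => ?_) fun n => ?_)
    · simp
    · simp [hq]

theorem theorem3p2 (Φ : GraphProperty) (c : ℕ) (hadj : Φ.CharacterizedByAdjacencies c)
    (p : ℕ → ℕ) (hpoly : ∃ q : Polynomial ℝ, ∀ n : ℕ, (p n : ℝ) = q.eval (n : ℝ))
    (hmono : Monotone p)
    (hbound : ∀ {V : Type} [Finite V] (G : SimpleGraph V),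
      Φ.Holds G → Nat.card V ≤ p G.vertexCoverNum.toNat) :
    ∃ (K : VCInstance → VCInstance) (size : Polynomial ℕ) (f : ℕ → ℕ),
      IsKernelization (largestInducedVC Φ) K (fun x => size.eval x) ∧
      (∀ I : VCInstance, (K I).n ≤ f I.X.card) ∧
      (fun x => (f x : ℝ)) =O[atTop] (fun x => (p x : ℝ) * (x : ℝ) ^ c) := by
  obtain ⟨q, hq⟩ := hpoly
  have hsol : ∀ (I : VCInstance) (P : Finset (Fin I.n)),
      Φ.Holds (I.G.induce (P : Set (Fin I.n))) → P.card ≤ p I.X.card := fun I P hP => by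
    have h := hbound _ hP
    have hcard : Nat.card (P : Set (Fin I.n)) = P.card := by simp
    rw [hcard] at h
    refine h.trans (hmono (ENat.toNat_le_of_le_natCast ?_))
    have hsub : (I.G.induce (P : Set (Fin I.n))).IsContained I.G :=
      ⟨(SimpleGraph.Embedding.induce _).toCopy⟩
    refine hsub.vertexCoverNum_le_vertexCoverNum.trans (I.cover.vertexCoverNum_le.trans ?_)
    simp
  by_cases hcase : c = 0 ∨ q = 0
  · -- solutions have at most `p 0` vertices
    have hsmall : ∀ (I : VCInstance) (P : Finset (Fin I.n)),
        Φ.Holds (I.G.induce (P : Set (Fin I.n))) → P.card ≤ p 0 * (I.X.card + 1) ^ 0 := by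
      intro I P hP
      rw [pow_zero, mul_one]
      rcases hcase with rfl | rfl
      · have h := hbound _ (hadj.holds_bot hP)
        rw [SimpleGraph.vertexCoverNum_eq_zero.mpr rfl] at h
        simpa using h
      · have h0 : ∀ n, p n = 0 := fun n => by exact_mod_cast (by simpa using hq n : (p n : ℝ) = 0)
        simpa [h0] using hsol I P hP
    have hparam : false = true ∧ 0 = c ∨ c = 0 ∨ p 0 = 0 := by
      refine Or.inr (hcase.imp id fun h => ?_)
      exact_mod_cast (by simpa [h] using hq 0 : (p 0 : ℝ) = 0)
    obtain ⟨K, size, hK, hn⟩ := exists_isKernelization hadj false hparam hsmall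
    refine ⟨K, size, fun _ => p 0, hK, fun I => by simpa using hn I, ?_⟩
    refine IsBigO.of_bound 1 (eventually_ge_atTop 1 |>.mono fun x hx => ?_)
    have h₁ : (p 0 : ℝ) ≤ p x := by exact_mod_cast hmono (Nat.zero_le x)
    have h₂ : (1 : ℝ) ≤ (x : ℝ) ^ c := one_le_pow₀ (by exact_mod_cast hx)
    rw [Real.norm_of_nonneg (by positivity), Real.norm_of_nonneg (by positivity), one_mul]
    exact h₁.trans (le_mul_of_one_le_right (by positivity) h₂)
  · push Not at hcase
    obtain ⟨C, d, hpC, hO⟩ := exists_le_mul_pow hq hcase.2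
    obtain ⟨K, size, hK, hn⟩ := exists_isKernelization hadj true (Or.inl ⟨rfl, rfl⟩)
      fun I P hP => (hsol I P hP).trans (hpC _)
    refine ⟨K, size, fun x => x + (2 * x + 1) ^ c * (C * (x + 1) ^ d), hK,
      fun I => by simpa using hn I, ?_⟩
    -- since `p` is not identically zero and `c` is positive, `p x * x ^ c` is at least `x`
    obtain ⟨m, hm⟩ : ∃ m, 1 ≤ p m := by
      by_contra! h
      refine hcase.2 (Polynomial.eq_zero_of_infinite_isRoot q
        ((Set.infinite_range_of_injective Nat.cast_injective).mono ?_))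
      rintro _ ⟨n, rfl⟩
      rw [Set.mem_ofPred_eq, Polynomial.IsRoot.def, ← hq, Nat.lt_one_iff.mp (h n), Nat.cast_zero]
    have h₁ : (fun x : ℕ => (x : ℝ)) =O[atTop] fun x => (p x : ℝ) * (x : ℝ) ^ c := by
      refine IsBigO.of_bound 1 (eventually_ge_atTop (m + 1) |>.mono fun x hx => ?_)
      have h₁ : (1 : ℝ) ≤ p x := by exact_mod_cast hm.trans (hmono (by omega))
      have h₂ : (x : ℝ) ≤ (x : ℝ) ^ c := le_self_pow₀ (by exact_mod_cast (by omega : 1 ≤ x)) hcase.1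
      rw [Real.norm_of_nonneg (by positivity), Real.norm_of_nonneg (by positivity), one_mul]
      exact h₂.trans (le_mul_of_one_le_left (by positivity) h₁)
    have h₂ : (fun x : ℕ => ((2 * x + 1 : ℕ) : ℝ) ^ c) =O[atTop] fun x => (x : ℝ) ^ c := by
      refine IsBigO.pow (IsBigO.of_bound 3 (eventually_ge_atTop 1 |>.mono fun x hx => ?_)) c
      have : (1 : ℝ) ≤ x := by exact_mod_cast hx
      rw [Real.norm_of_nonneg (by positivity), Real.norm_of_nonneg (by positivity)]
      push_cast
      linarith
    have h₃ : (fun x : ℕ => (x : ℝ) + ((C * (x + 1) ^ d : ℕ) : ℝ) * ((2 * x + 1 : ℕ) : ℝ) ^ c)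
        =O[atTop] fun x => (p x : ℝ) * (x : ℝ) ^ c := h₁.add (hO.mul h₂)
    refine h₃.congr_left fun x => ?_
    push_cast
    ring
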